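/- All graphs are finite and simple, $\mathbb K$ is a field, and for a graph $G$ we let $S_G=\mathbb K[x_a : a\in V(G)]$ and $I_G=(x_ax_b : \{a,b\}\in E(G))\subset S_G$. For an $S_G$-module $M$ let $\operatorname{depth}(M)=\min\{i : \operatorname{Ext}^i_{S_G}(\mathbb K,M)\neq 0\}$, where $\mathbb K=S_G/(x_a : a\in V(G))$. Fan graphs. Let $K_n$ be the complete graph on $[n]$, let $W\subseteq [n]$ and let $W=W_1\sqcup\cdots\sqcup W_k$ be a partition into nonempty sets with enumerations $W_i=\{w_{i,1},\ldots,w_{i,r_i}\}$. For all $i\in[k]$ and $j\in[r_i]$ let an integer $a_{i,j}>j$ be given. The $k$-fan graph $F_k^W(K_n)$ is the union of $K_n$ and of complete graphs $K_{a_{i,j}}$ on $a_{i,j}$ vertices with $V(K_n)\cap V(K_{a_{i,j}})=\{w_{i,1},\ldots,w_{i,j}\}$, where the $a_{i,j}-j$ vertices of $K_{a_{i,j}}$ outside $K_n$ are new and belong to no other of these complete graphs. The operation $\circ$. For $i=1,2$ let $f_i$ be a leaf (a vertex of degree one) of a graph $G_i$ and $v_i$ its neighbor. Then $(G_1,f_1)\circ(G_2,f_2)$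 is the graph obtained from the disjoint union of $G_1$ and $G_2$ by removing $f_1,f_2$ and then identifying $v_1$ with $v_2$. Theorem. Let $G=(G_1,f_1)\circ(G_2,f_2)$, where for $i=1,2$ the graph $G_i=F_{k_i}^{W_i}(K_{n_i})$ is a $k_i$-fan graph with $n_i\ge 2$ and $k_i\ge 1$, $f_i$ is a leaf of $G_i$, $v_i$ is its neighbor, and $W_i=W_{i,1}\sqcup\cdots\sqcup W_{i,k_i}$ is the partition that defines $G_i$, with the parts numbered so that $v_i\in W_{i,1}$. Let $$T_i=\max\{|W_{i,1}|,|W_{i,2}|,\ldots,|W_{i,k_i}|\},\qquad T_i'=\max\{|W_{i,1}|-1,|W_{i,2}|,\ldots,|W_{i,k_i}|\},$$ and $t=|\{i\in\{1,2\} : T_i'\neq T_i-1\}|$. Then all the depths below are finite and $$\operatorname{depth}(S_G/I_G)=\operatorname{depth}(S_{G_1}/I_{G_1})+\operatorname{depth}(S_{G_2}/I_{G_2})-s,$$ where $s=1$ if $t\le 1$, and $s=2$ if $t=2$. -/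

import Mathlib

open CategoryTheory

universe u v

/-! ### Edge ideals and depth -/

/-- The edge ideal `I_G = (x_a x_b : {a, b} ∈ E(G))` of a simple graph `G`, in the polynomial ring
`S_G = K[x_a : a ∈ V(G)]`. -/
noncomputable def SimpleGraph.edgeIdeal (K : Type u) [Field K] {V : Type v} (G : SimpleGraph V) :
    Ideal (MvPolynomial V K) :=
  Ideal.span {p | ∃ a b : V, G.Adj a b ∧ p = MvPolynomial.X a * MvPolynomial.X b}

/-- The depth of a module `M` over the polynomial ring `S = K[x_a : a ∈ V]`, namely
`min {i | Ext^i_S(K, M) ≠ 0}`, where `K` is the residue field `S / (x_a : a ∈ V)`. It is `⊤` if all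
these `Ext` groups vanish. -/
noncomputable def polyDepth (K : Type u) [Field K] (V : Type v) (M : Type (max u v))
    [AddCommGroup M] [Module (MvPolynomial V K) M] : ℕ∞ :=
  ⨅ (i : ℕ) (_ : Nontrivial (Abelian.Ext.{max u v}
    (ModuleCat.of (MvPolynomial V K) (MvPolynomial V K ⧸ MvPolynomial.idealOfVars V K))
    (ModuleCat.of (MvPolynomial V K) M) i)), (i : ℕ∞)

/-- `depth (S_G / I_G)`. -/
noncomputable def SimpleGraph.edgeDepth (K : Type u) [Field K] {V : Type v} (G : SimpleGraph V) :
    ℕ∞ :=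
  polyDepth K V (MvPolynomial V K ⧸ G.edgeIdeal K)

/-! ### Fan graphs -/

/-- The data defining a `k`-fan graph `F_k^W(K_n)`: pairwise disjoint nonempty subsets
`W_i = {w_{i,1}, …, w_{i,r_i}}` (`i ∈ [k]`) of the vertex set `[n]` of `K_n`, each with an
enumeration, and sizes `a_{i,j} > j` of the cliques `K_{a_{i,j}}` to be attached. Indices start at
`0` here, so that `j : Fin (r i)` stands for the index `j + 1`. -/
structure FanData where
  /-- the number of vertices of the central clique -/
  n : ℕ
  /-- the number of fans -/
  k : ℕ
  /-- the sizes of the sets `W_i` -/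
  r : Fin k → ℕ
  r_pos : ∀ i, 0 < r i
  /-- the enumerations `w_{i,1}, …, w_{i,r_i}` -/
  w : (i : Fin k) → Fin (r i) → Fin n
  w_injective : ∀ i, Function.Injective (w i)
  w_disjoint : ∀ i i', i ≠ i' → ∀ j j', w i j ≠ w i' j'
  /-- the sizes of the attached cliques -/
  a : (i : Fin k) → Fin (r i) → ℕ
  lt_a : ∀ (i : Fin k) (j : Fin (r i)), (j : ℕ) + 1 < a i j

namespace FanData

variable (F : FanData)

/-- The subset `W_i` of `[n]`. -/
def part (i : Fin F.k) : Finset (Fin F.n) := Finset.univ.image (F.w i)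

/-- The vertices of the fan graph: those of `K_n`, and `h_{i,j} = a_{i,j} - j` new vertices for each
attached clique `K_{a_{i,j}}`. -/
abbrev Vertex : Type :=
  Fin F.n ⊕ (Σ i : Fin F.k, Σ j : Fin (F.r i), Fin (F.a i j - ((j : ℕ) + 1)))

/-- The vertex set `{w_{i,1}, …, w_{i,j}} ∪ {new vertices}` of the attached clique
`K_{a_{i,j}}`. -/
def branchClique (i : Fin F.k) (j : Fin (F.r i)) : Set F.Vertex :=
  {x | (∃ l : Fin (F.r i), l ≤ j ∧ x = Sum.inl (F.w i l)) ∨ ∃ y, x = Sum.inr ⟨i, j, y⟩}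

/-- The fan graph `F_k^W(K_n)`: the union of the complete graph on `[n]` and of the complete graphs
on the sets `V(K_{a_{i,j}})`. -/
def graph : SimpleGraph F.Vertex where
  Adj x y := x ≠ y ∧
    ((∃ c d : Fin F.n, x = Sum.inl c ∧ y = Sum.inl d) ∨
      ∃ i j, x ∈ F.branchClique i j ∧ y ∈ F.branchClique i j)
  symm := ⟨by
    rintro x y ⟨hne, ⟨c, d, hx, hy⟩ | ⟨i, j, hx, hy⟩⟩
    · exact ⟨hne.symm, Or.inl ⟨d, c, hy, hx⟩⟩
    · exact ⟨hne.symm, Or.inr ⟨i, j, hy, hx⟩⟩⟩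
  loopless := ⟨fun _ h => h.1 rfl⟩

/-- `T = max {|W_1|, …, |W_k|}`. -/
def maxPart : ℕ := Finset.univ.sup fun i => (F.part i).card

/-- `T'`: the maximum of `|W_p| - 1` and of the `|W_i|` with `i ≠ p`. -/
def maxPart' (p : Fin F.k) : ℕ :=
  Finset.univ.sup fun i => if i = p then (F.part i).card - 1 else (F.part i).card

end FanData

/-! ### The `∘` operation -/

/-- `f` is a leaf (a vertex of degree one) of `G` and `v` is its neighbor. -/
def SimpleGraph.IsLeafAt {V : Type v} (G : SimpleGraph V) (f v : V) : Prop :=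
  G.neighborSet f = {v}

/-- The vertices of `(G₁, f₁) ∘ (G₂, f₂)`: `f₁` and `f₂` are removed, and the neighbors `v₁` and
`v₂` become one vertex, which is represented by `v₁`. -/
abbrev CircVertex {V₁ V₂ : Type v} (f₁ : V₁) (f₂ v₂ : V₂) : Type v :=
  {x : V₁ // x ≠ f₁} ⊕ {x : V₂ // x ≠ f₂ ∧ x ≠ v₂}

/-- The graph `(G₁, f₁) ∘ (G₂, f₂)`, where `v₁` and `v₂` are the neighbors of the leaves `f₁` and
`f₂`: the leaves are removed and `v₁` and `v₂` are identified. -/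
def SimpleGraph.circ {V₁ V₂ : Type v} (G₁ : SimpleGraph V₁) (G₂ : SimpleGraph V₂)
    (f₁ v₁ : V₁) (f₂ v₂ : V₂) : SimpleGraph (CircVertex f₁ f₂ v₂) where
  Adj
    | Sum.inl x, Sum.inl y => G₁.Adj x y
    | Sum.inr x, Sum.inr y => G₂.Adj x y
    | Sum.inl x, Sum.inr y => x.1 = v₁ ∧ G₂.Adj v₂ y
    | Sum.inr x, Sum.inl y => y.1 = v₁ ∧ G₂.Adj v₂ x
  symm := ⟨by
    rintro (x | x) (y | y) h
    · exact G₁.adj_symm h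
    · exact h
    · exact h
    · exact G₂.adj_symm h⟩
  loopless := ⟨by
    rintro (x | x) h
    · exact G₁.ne_of_adj h rfl
    · exact G₂.ne_of_adj h rfl⟩

/-! The graphs involved are chordal, and for a graph with an elimination order the depth of `S/I_G`
is the least size of a maximal independent set.

Lower bound (`subsingleton_ext_of_lt_card`): let `f` come last among the non-isolated vertices and
let `c` be a neighbor of `f`. In `0 → S/(I : x_c) → S/I → S/(I + (x_c)) → 0` both outer terms come
from vertex deletions, and their maximal independent sets remain maximal in the original graph. Once
no edge is left, each remaining variable is regular and raises the bound by one.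

Upper bound (`nontrivial_ext_card`): let `A` be maximal independent, `J = (x_v : v ∉ A)` and `s = ∏
x_a` over `a ∈ A`. Then `I ⊆ J` and `sJ ⊆ I`, so multiplication by `s` on `S/J` factors through
`S/I`. It kills `Ext(𝕂, S/J)`, so `𝕂` is replaced by `N = S/(J + (x_a² : a ∈ A))`, which is filtered
by copies of `𝕂`. Since `s ∉ J + (x_a²)`, it acts nontrivially on `Ext^{|A|}(N, S/J)`.

The rest is counting. Let `N_i` be the number of cliques attached in `G_i`. A central vertex and one
new vertex from each attached clique avoiding it form a maximal independent set. This gives depth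
`N_i + 1 - T_i` for `G_i`, least size `m_i = N_i + 1 - |W_{i,1}|` among the sets containing `v_i`,
and `l_i = N_i - T_i'` after deleting `f_i` and `v_i`. Splitting on whether the glued vertex is
used, the depth of `G` is `min (m_1 + m_2 - 1) (l_1 + l_2)`. -/

/-! ### Quotients by ideals and `Ext` -/

section ExtQuotient

universe w

variable {R : Type w} [CommRing R]

/-- `R ⧸ I` as an object of the category of modules. -/
noncomputable abbrev quotObj (I : Ideal R) : ModuleCat.{w} R := ModuleCat.of R (R ⧸ I)

/-- Multiplication by `r` as a map `R ⧸ I ⟶ R ⧸ J`, when `r I ⊆ J`. -/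
noncomputable def mulHom (I J : Ideal R) (r : R) (h : ∀ p ∈ I, r * p ∈ J) :
    quotObj I ⟶ quotObj J :=
  ModuleCat.ofHom (Submodule.mapQ I J (LinearMap.lsmul R R r) h)

lemma mulHom_comp_mulHom (I J L : Ideal R) (r s : R) (h : ∀ p ∈ I, r * p ∈ J)
    (h' : ∀ p ∈ J, s * p ∈ L) (h'' : ∀ p ∈ I, (s * r) * p ∈ L) :
    mulHom I J r h ≫ mulHom J L s h' = mulHom I L (s * r) h'' := by
  refine ModuleCat.hom_ext (Submodule.linearMap_qext _ (LinearMap.ext fun p => ?_))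
  exact congrArg (Submodule.Quotient.mk (p := L)) (mul_assoc s r p).symm

lemma mulHom_self (I : Ideal R) (r : R) (h : ∀ p ∈ I, r * p ∈ I) :
    mulHom I I r h = r • 𝟙 (quotObj I) :=
  ModuleCat.hom_ext (Submodule.linearMap_qext _ (LinearMap.ext fun _ => rfl))

lemma smul_id_eq_zero {I : Ideal R} {r : R} (h : r ∈ I) : r • 𝟙 (quotObj I) = 0 := by
  rw [← mulHom_self I r fun p hp => I.mul_mem_left r hp]
  refine ModuleCat.hom_ext (Submodule.linearMap_qext _ (LinearMap.ext fun p => ?_))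
  exact (Submodule.Quotient.mk_eq_zero I).2 (I.mul_mem_right p h)

/-- The sequence `0 → R ⧸ (I : r) → R ⧸ I → R ⧸ (I + (r)) → 0`. -/
noncomputable abbrev colonSequence (I' I I'' : Ideal R) (r : R) (h : ∀ p, r * p ∈ I ↔ p ∈ I')
    (h' : I'' = I ⊔ Ideal.span {r}) : ShortComplex (ModuleCat.{w} R) :=
  ShortComplex.mk (mulHom I' I r fun p hp => (h p).2 hp)
    (mulHom I I'' 1 fun p hp => by rw [one_mul, h']; exact Ideal.mem_sup_left hp) (by
      refine ModuleCat.hom_ext (Submodule.linearMap_qext _ (LinearMap.ext fun p => ?_))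
      refine (Submodule.Quotient.mk_eq_zero I'').2 (I''.mul_mem_left 1 (I''.mul_mem_right p ?_))
      exact h' ▸ Ideal.mem_sup_right (Ideal.mem_span_singleton_self r))

lemma colonSequence_shortExact (I' I I'' : Ideal R) (r : R) (h : ∀ p, r * p ∈ I ↔ p ∈ I')
    (h' : I'' = I ⊔ Ideal.span {r}) : (colonSequence I' I I'' r h h').ShortExact := by
  apply ModuleCat.shortComplex_shortExact
  · intro y
    obtain ⟨p, rfl⟩ := Submodule.Quotient.mk_surjective _ y
    constructor
    · intro hp
      have hp' : p ∈ I ⊔ Ideal.span {r} := by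
        rw [← h', ← one_mul p]
        exact (Submodule.Quotient.mk_eq_zero _).1 hp
      obtain ⟨q, hq, z, hz, rfl⟩ := Submodule.mem_sup.1 hp'
      obtain ⟨a, rfl⟩ := Ideal.mem_span_singleton'.1 hz
      refine ⟨Submodule.Quotient.mk a, (Submodule.Quotient.eq _).2 ?_⟩
      have : r * a - (q + a * r) = -q := by ring
      exact this ▸ I.neg_mem hq
    · rintro ⟨x, hx⟩
      rw [← hx]
      exact (colonSequence I' I I'' r h h').moduleCat_zero_apply x
  · refine (injective_iff_map_eq_zero _).2 fun x hx => ?_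
    obtain ⟨p, rfl⟩ := Submodule.Quotient.mk_surjective _ x
    exact (Submodule.Quotient.mk_eq_zero _).2 ((h p).1 ((Submodule.Quotient.mk_eq_zero _).1 hx))
  · intro y
    obtain ⟨p, rfl⟩ := Submodule.Quotient.mk_surjective _ y
    exact ⟨Submodule.Quotient.mk p, congrArg Submodule.Quotient.mk (one_mul p)⟩

open Abelian

variable {X Y : ModuleCat.{w} R} {S : ShortComplex (ModuleCat.{w} R)}

lemma CategoryTheory.Abelian.Ext.subsingleton_of_shortExact_covariant (hS : S.ShortExact) {i : ℕ}
    (h₁ : Subsingleton (Ext.{w} X S.X₁ i)) (h₃ : Subsingleton (Ext.{w} X S.X₃ i)) :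
    Subsingleton (Ext.{w} X S.X₂ i) := by
  refine subsingleton_of_forall_eq 0 fun x => ?_
  obtain ⟨y, rfl⟩ := Ext.covariant_sequence_exact₂ X hS x (Subsingleton.elim _ _)
  rw [Subsingleton.elim y 0, Ext.zero_comp]

lemma CategoryTheory.Abelian.Ext.subsingleton_of_shortExact_contravariant (hS : S.ShortExact)
    {i : ℕ} (h₁ : Subsingleton (Ext.{w} S.X₁ Y i)) (h₃ : Subsingleton (Ext.{w} S.X₃ Y i)) :
    Subsingleton (Ext.{w} S.X₂ Y i) := by
  refine subsingleton_of_forall_eq 0 fun x => ?_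
  obtain ⟨y, rfl⟩ := Ext.contravariant_sequence_exact₂ hS Y x (Subsingleton.elim _ _)
  rw [Subsingleton.elim y 0, Ext.comp_zero]

lemma CategoryTheory.Abelian.Ext.smul_eq_zero_of_left {r : R} (hX : r • 𝟙 X = 0) {i : ℕ}
    (x : Ext.{w} X Y i) : r • x = 0 := by
  have : r • x = (Ext.mk₀ (r • 𝟙 X)).comp x (zero_add i) := by simp [Ext.mk₀_smul]
  rw [this, hX, Ext.mk₀_zero, Ext.zero_comp]

/-- If `r` is a nonzerodivisor on `R ⧸ I` that kills `X`, then vanishing of the `Ext` groups from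
`X` to `R ⧸ (I + (r))` in degrees below `d` gives vanishing for `R ⧸ I` in degrees below `d + 1`. -/
lemma subsingleton_ext_of_regular {I I'' : Ideal R} {r : R} (h : ∀ p, r * p ∈ I ↔ p ∈ I)
    (h' : I'' = I ⊔ Ideal.span {r}) (hX : r • 𝟙 X = 0) {d : ℕ}
    (hd : ∀ i < d, Subsingleton (Ext.{w} X (quotObj I'') i)) :
    ∀ i < d + 1, Subsingleton (Ext.{w} X (quotObj I) i) := by
  intro i hi
  have hS := colonSequence_shortExact I I I'' r h h'
  -- Multiplication by `r` on `R ⧸ I` induces multiplication by `r` on `Ext`, which is zero because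
  -- `r` kills `X`.
  have key : ∀ x : Ext.{w} X (quotObj I) i,
      x.comp (Ext.mk₀ (colonSequence I I I'' r h h').f) (add_zero i) = 0 := fun x => by
    have : (colonSequence I I I'' r h h').f = r • 𝟙 (quotObj I) := mulHom_self I r _
    rw [this, ← Ext.smul_eq_comp_mk₀, Ext.smul_eq_zero_of_left hX]
  refine subsingleton_of_forall_eq 0 fun x => ?_
  rcases i with _ | i
  · have := hS.mono_f
    refine Ext.postcomp_mk₀_injective_of_mono X (colonSequence I I I'' r h h').f ?_
    rw [map_zero]
    exact key x
  · obtain ⟨y, rfl⟩ := Ext.covariant_sequence_exact₁ X hS x (key x) rfl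
    have := hd i (by omega)
    rw [show y = 0 from Subsingleton.elim (α := Ext.{w} X (quotObj I'') i) y 0, Ext.zero_comp]

/-- If `r` is a nonzerodivisor on `R ⧸ I`, an element of `Ext` of degree `i` into
`R ⧸ (I + (r))` not killed by `s` gives one of degree `i + 1` into `R ⧸ I`, provided that the `Ext`
group into `R ⧸ I` of degree `i` vanishes. -/
lemma exists_smul_ne_zero_of_regular {I I'' : Ideal R} {r s : R} (h : ∀ p, r * p ∈ I ↔ p ∈ I)
    (h' : I'' = I ⊔ Ideal.span {r}) {i : ℕ} (hi : Subsingleton (Ext.{w} X (quotObj I) i))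
    (hs : ∃ x : Ext.{w} X (quotObj I'') i, s • x ≠ 0) :
    ∃ x : Ext.{w} X (quotObj I) (i + 1), s • x ≠ 0 := by
  obtain ⟨x, hx⟩ := hs
  have hS := colonSequence_shortExact I I I'' r h h'
  -- The connecting map is linear, and injective because the preceding `Ext` group vanishes.
  refine ⟨Ext.comp (Y := (colonSequence I I I'' r h h').X₃) x hS.extClass rfl, fun h0 => hx ?_⟩
  rw [← Ext.smul_comp] at h0
  obtain ⟨y, hy⟩ := Ext.covariant_sequence_exact₃ X hS _ rfl h0
  refine hy.symm.trans ?_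
  rw [show y = 0 from Subsingleton.elim (α := Ext.{w} X (quotObj I) i) y 0, Ext.zero_comp]

/-- If multiplication by `s` on `R ⧸ J` factors as a map through `R ⧸ I` and is nonzero on an `Ext`
group into `R ⧸ J`, then the `Ext` group into `R ⧸ I` is nonzero. -/
lemma nontrivial_ext_of_factor {I J : Ideal R} (hIJ : I ≤ J) {s : R} (hs : ∀ p ∈ J, s * p ∈ I)
    {i : ℕ} (hx : ∃ x : Ext.{w} X (quotObj J) i, s • x ≠ 0) :
    Nontrivial (Ext.{w} X (quotObj I) i) := by
  by_contra hn
  rw [not_nontrivial_iff_subsingleton] at hn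
  obtain ⟨x, hx⟩ := hx
  have hIJ' : ∀ p ∈ I, 1 * p ∈ J := fun p hp => by rw [one_mul]; exact hIJ hp
  have h1 := mulHom_comp_mulHom J I J s 1 hs hIJ' fun p hp => J.mul_mem_left _ hp
  rw [mulHom_self, one_mul] at h1
  rw [Ext.smul_eq_comp_mk₀, ← h1, ← Ext.mk₀_comp_mk₀, ← Ext.comp_assoc_of_second_deg_zero,
    Subsingleton.elim (x.comp (Ext.mk₀ (mulHom J I s hs)) (add_zero i)) 0, Ext.zero_comp] at hx
  exact hx rfl

end ExtQuotient

/-! ### Monomial ideals -/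

section Monomial

open MvPolynomial

variable (K : Type u) [Field K] {V : Type v}

/-- The monomial ideal spanned by the monomials with exponent in an upper set. -/
noncomputable def monomialIdeal (U : UpperSet (V →₀ ℕ)) : Ideal (MvPolynomial V K) :=
  restrictSupportIdeal (R := K) U U.upper

variable {K}

lemma mem_monomialIdeal {U : UpperSet (V →₀ ℕ)} {p : MvPolynomial V K} :
    p ∈ monomialIdeal K U ↔ ∀ m, coeff m p ≠ 0 → m ∈ U :=
  ⟨fun h _ hm => h (mem_support_iff.2 hm), fun h m hm => h m (mem_support_iff.1 hm)⟩

lemma monomial_mem_monomialIdeal {U : UpperSet (V →₀ ℕ)} {m : V →₀ ℕ} (a : K) (h : m ∈ U) :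
    monomial m a ∈ monomialIdeal K U := by
  classical
  refine mem_monomialIdeal.2 fun m' hm' => ?_
  rw [coeff_monomial] at hm'
  split_ifs at hm' with h'
  · exact h' ▸ h
  · exact absurd rfl hm'

lemma monomial_mem_monomialIdeal_iff {U : UpperSet (V →₀ ℕ)} {m : V →₀ ℕ} :
    monomial m (1 : K) ∈ monomialIdeal K U ↔ m ∈ U := by
  classical
  exact ⟨fun h => mem_monomialIdeal.1 h m (by simp), monomial_mem_monomialIdeal 1⟩

lemma monomialIdeal_le_iff {U : UpperSet (V →₀ ℕ)} {J : Ideal (MvPolynomial V K)} :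
    monomialIdeal K U ≤ J ↔ ∀ m ∈ U, monomial m (1 : K) ∈ J := by
  refine ⟨fun h m hm => h (monomial_mem_monomialIdeal 1 hm), fun h p hp => ?_⟩
  rw [← support_sum_monomial_coeff p]
  refine J.sum_mem fun m hm => ?_
  have : monomial m (coeff m p) = C (coeff m p) * monomial m (1 : K) := by
    rw [C_mul_monomial, mul_one]
  rw [this]
  exact J.mul_mem_left _ (h m (mem_monomialIdeal.1 hp m (mem_support_iff.1 hm)))

/-- Colon ideals by a monomial are computed on exponents, by shifting. -/
lemma monomial_mul_mem_monomialIdeal {U U' : UpperSet (V →₀ ℕ)} {m₀ : V →₀ ℕ}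
    (h : ∀ m, m₀ + m ∈ U ↔ m ∈ U') (p : MvPolynomial V K) :
    monomial m₀ 1 * p ∈ monomialIdeal K U ↔ p ∈ monomialIdeal K U' := by
  classical
  simp only [mem_monomialIdeal]
  constructor
  · intro H m hm
    exact (h m).1 (H _ (by rwa [coeff_monomial_mul, one_mul]))
  · intro H m hm
    rw [coeff_monomial_mul'] at hm
    split_ifs at hm with hle
    · rw [one_mul] at hm
      rw [← add_tsub_cancel_of_le hle]
      exact (h _).2 (H _ hm)
    · exact absurd rfl hm

lemma monomialIdeal_eq_sup {U U'' : UpperSet (V →₀ ℕ)} {m₀ : V →₀ ℕ}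
    (h : ∀ m, m ∈ U'' ↔ m ∈ U ∨ m₀ ≤ m) :
    monomialIdeal K U'' = monomialIdeal K U ⊔ Ideal.span {monomial m₀ 1} := by
  refine le_antisymm (monomialIdeal_le_iff.2 fun m hm => ?_) (sup_le ?_ ?_)
  · rcases (h m).1 hm with hm | hm
    · exact Ideal.mem_sup_left (monomial_mem_monomialIdeal 1 hm)
    · refine Ideal.mem_sup_right (Ideal.mem_span_singleton'.2 ⟨monomial (m - m₀) 1, ?_⟩)
      rw [monomial_mul, one_mul, tsub_add_cancel_of_le hm]
  · exact monomialIdeal_le_iff.2 fun m hm => monomial_mem_monomialIdeal 1 ((h m).2 (Or.inl hm))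
  · rw [Ideal.span_le, Set.singleton_subset_iff]
    exact monomial_mem_monomialIdeal 1 ((h _).2 (Or.inr le_rfl))

/-- The exponents of the monomials that involve a variable from `B` or both ends of an edge of
`G`. -/
def edgeExponents (G : SimpleGraph V) (B : Set V) : UpperSet (V →₀ ℕ) where
  carrier := {m | (∃ b ∈ B, m b ≠ 0) ∨ ∃ a b, G.Adj a b ∧ m a ≠ 0 ∧ m b ≠ 0}
  upper' := by
    have key : ∀ {m m' : V →₀ ℕ} (_ : m ≤ m') {a : V}, m a ≠ 0 → m' a ≠ 0 := fun h a ha =>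
      Nat.pos_iff_ne_zero.1 ((Nat.pos_of_ne_zero ha).trans_le (h a))
    rintro m m' h (⟨b, hb, hm⟩ | ⟨a, b, hab, ha, hb⟩)
    · exact Or.inl ⟨b, hb, key h hm⟩
    · exact Or.inr ⟨a, b, hab, key h ha, key h hb⟩

lemma mem_edgeExponents {G : SimpleGraph V} {B : Set V} {m : V →₀ ℕ} :
    m ∈ edgeExponents G B ↔ (∃ b ∈ B, m b ≠ 0) ∨ ∃ a b, G.Adj a b ∧ m a ≠ 0 ∧ m b ≠ 0 := Iff.rfl

/-- The exponents of the monomials that involve a variable outside `A` or the square of a variable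
in `D`. -/
def squareExponents (A D : Set V) : UpperSet (V →₀ ℕ) where
  carrier := {m | (∃ v ∉ A, m v ≠ 0) ∨ ∃ v ∈ D, 2 ≤ m v}
  upper' := by
    rintro m m' h (⟨b, hb, hm⟩ | ⟨a, ha, hm⟩)
    · exact Or.inl ⟨b, hb, Nat.pos_iff_ne_zero.1 ((Nat.pos_of_ne_zero hm).trans_le (h b))⟩
    · exact Or.inr ⟨a, ha, hm.trans (h a)⟩

lemma mem_squareExponents {A D : Set V} {m : V →₀ ℕ} :
    m ∈ squareExponents A D ↔ (∃ v ∉ A, m v ≠ 0) ∨ ∃ v ∈ D, 2 ≤ m v := Iff.rfl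

lemma edgeIdeal_eq_monomialIdeal (G : SimpleGraph V) :
    G.edgeIdeal K = monomialIdeal K (edgeExponents G ∅) := by
  classical
  refine le_antisymm (Ideal.span_le.2 ?_) (monomialIdeal_le_iff.2 ?_)
  · rintro _ ⟨a, b, hab, rfl⟩
    rw [X, X, monomial_mul, one_mul]
    refine monomial_mem_monomialIdeal 1 (Or.inr ⟨a, b, hab, ?_, ?_⟩) <;> simp
  · rintro m (⟨b, hb, -⟩ | ⟨a, b, hab, ha, hb⟩)
    · exact absurd hb (Set.notMem_empty b)
    · have hle : Finsupp.single a 1 + Finsupp.single b 1 ≤ m := by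
        intro v
        rw [Finsupp.add_apply, Finsupp.single_apply, Finsupp.single_apply]
        split_ifs with h h' <;> subst_vars <;> first | omega | exact absurd rfl hab.ne
      have : monomial m (1 : K) =
          monomial (m - (Finsupp.single a 1 + Finsupp.single b 1)) 1 * (X a * X b) := by
        rw [X, X, monomial_mul, monomial_mul, one_mul, one_mul, tsub_add_cancel_of_le hle]
      rw [this]
      exact Ideal.mul_mem_left _ _ (Ideal.subset_span ⟨a, b, hab, rfl⟩)

lemma idealOfVars_eq_monomialIdeal :
    idealOfVars V K = monomialIdeal K (squareExponents ∅ ∅) := by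
  classical
  refine le_antisymm (Ideal.span_le.2 ?_) (monomialIdeal_le_iff.2 ?_)
  · rintro _ ⟨a, rfl⟩
    exact monomial_mem_monomialIdeal 1 (Or.inl ⟨a, Set.notMem_empty a, by simp⟩)
  · rintro m (⟨b, -, hm⟩ | ⟨b, hb, -⟩)
    · have hle : Finsupp.single b 1 ≤ m := by
        rw [Finsupp.single_le_iff]
        omega
      have : monomial m (1 : K) = monomial (m - Finsupp.single b 1) 1 * X b := by
        rw [X, monomial_mul, one_mul, tsub_add_cancel_of_le hle]
      rw [this]
      exact Ideal.mul_mem_left _ _ (Ideal.subset_span ⟨b, rfl⟩)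
    · exact absurd hb (Set.notMem_empty b)

/-- Computes `I : x_c`: once `x_c` is present, any neighbor of `c` completes an edge, so the
neighbors are deleted too. -/
lemma single_one_add_mem_edgeExponents {G : SimpleGraph V} {B : Set V} {c : V} (hc : c ∉ B)
    (m : V →₀ ℕ) :
    Finsupp.single c 1 + m ∈ edgeExponents G B ↔ m ∈ edgeExponents G (B ∪ G.neighborSet c) := by
  classical
  have key : ∀ a, (Finsupp.single c 1 + m : V →₀ ℕ) a ≠ 0 ↔ a = c ∨ m a ≠ 0 := fun a => by
    rw [Finsupp.add_apply, Finsupp.single_apply]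
    split_ifs with h
    · simp [h]
    · simp [Ne.symm h]
  simp only [mem_edgeExponents, key]
  constructor
  · rintro (⟨b, hb, rfl | hm⟩ | ⟨a, b, hab, rfl | ha, rfl | hb⟩)
    · exact absurd hb hc
    · exact Or.inl ⟨b, Or.inl hb, hm⟩
    · exact absurd rfl hab.ne
    · exact Or.inl ⟨b, Or.inr hab, hb⟩
    · exact Or.inl ⟨a, Or.inr hab.symm, ha⟩
    · exact Or.inr ⟨a, b, hab, ha, hb⟩
  · rintro (⟨b, hb | hb, hm⟩ | ⟨a, b, hab, ha, hb⟩)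
    · exact Or.inl ⟨b, hb, Or.inr hm⟩
    · exact Or.inr ⟨c, b, hb, Or.inl rfl, Or.inr hm⟩
    · exact Or.inr ⟨a, b, hab, Or.inr ha, Or.inr hb⟩

lemma mem_edgeExponents_insert {G : SimpleGraph V} {B : Set V} {c : V} (m : V →₀ ℕ) :
    m ∈ edgeExponents G (insert c B) ↔ m ∈ edgeExponents G B ∨ Finsupp.single c 1 ≤ m := by
  simp only [mem_edgeExponents, Finsupp.single_le_iff, Nat.one_le_iff_ne_zero,
    Set.exists_mem_insert]
  rw [or_assoc, or_comm]

/-- Makes `x_c²` a nonzerodivisor: no generator of the ideal involves `x_c`. -/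
lemma single_two_add_mem_squareExponents {A D : Set V} {c : V} (hc : c ∈ A) (hcD : c ∉ D)
    (m : V →₀ ℕ) :
    Finsupp.single c 2 + m ∈ squareExponents A D ↔ m ∈ squareExponents A D := by
  have key : ∀ a, a ≠ c → (Finsupp.single c 2 + m : V →₀ ℕ) a = m a := fun a ha => by simp [ha]
  simp only [mem_squareExponents]
  refine or_congr (exists_congr fun a => and_congr_right fun ha => ?_)
    (exists_congr fun a => and_congr_right fun ha => ?_)
  · rw [key a (ne_of_mem_of_not_mem hc ha).symm]
  · rw [key a (ne_of_mem_of_not_mem ha hcD)]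

lemma mem_squareExponents_insert {A D : Set V} {c : V} (m : V →₀ ℕ) :
    m ∈ squareExponents A (insert c D) ↔ m ∈ squareExponents A D ∨ Finsupp.single c 2 ≤ m := by
  simp only [mem_squareExponents, Finsupp.single_le_iff, Set.exists_mem_insert]
  rw [or_assoc, or_comm (b := 2 ≤ m c)]

/-- With `mem_squareExponents_iff_insert`: freeing `x_c` up to its square gives an extension of the
old module by itself, `x_c` generating the submodule. -/
lemma single_one_add_mem_squareExponents {D : Set V} {c : V} (hc : c ∉ D) (m : V →₀ ℕ) :
    Finsupp.single c 1 + m ∈ squareExponents (insert c D) (insert c D) ↔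
      m ∈ squareExponents D D := by
  have key : ∀ a, a ≠ c → (Finsupp.single c 1 + m : V →₀ ℕ) a = m a := fun a ha => by simp [ha]
  have keyc : (Finsupp.single c 1 + m : V →₀ ℕ) c = 1 + m c := by simp
  simp only [mem_squareExponents, Set.mem_insert_iff, not_or]
  constructor
  · rintro (⟨a, ⟨hac, haD⟩, hm⟩ | ⟨a, rfl | ha, hm⟩)
    · exact Or.inl ⟨a, haD, key a hac ▸ hm⟩
    · exact Or.inl ⟨a, hc, by omega⟩
    · exact Or.inr ⟨a, ha, key a (ne_of_mem_of_not_mem ha hc) ▸ hm⟩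
  · rintro (⟨a, ha, hm⟩ | ⟨a, ha, hm⟩)
    · by_cases hac : a = c
      · subst hac
        exact Or.inr ⟨a, Or.inl rfl, by omega⟩
      · exact Or.inl ⟨a, ⟨hac, ha⟩, (key a hac).symm ▸ hm⟩
    · exact Or.inr ⟨a, Or.inr ha, (key a (ne_of_mem_of_not_mem ha hc)).symm ▸ hm⟩

lemma mem_squareExponents_iff_insert {D : Set V} {c : V} (hc : c ∉ D) (m : V →₀ ℕ) :
    m ∈ squareExponents D D ↔
      m ∈ squareExponents (insert c D) (insert c D) ∨ Finsupp.single c 1 ≤ m := by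
  simp only [mem_squareExponents, Finsupp.single_le_iff, Nat.one_le_iff_ne_zero,
    Set.mem_insert_iff, not_or]
  constructor
  · rintro (⟨a, ha, hm⟩ | h)
    · by_cases hac : a = c
      · exact Or.inr (hac ▸ hm)
      · exact Or.inl (Or.inl ⟨a, ⟨hac, ha⟩, hm⟩)
    · exact Or.inl (Or.inr (h.imp fun _ h => ⟨Or.inr h.1, h.2⟩))
  · rintro ((⟨a, ha, hm⟩ | ⟨a, rfl | ha, hm⟩) | h)
    · exact Or.inl ⟨a, ha.2, hm⟩
    · exact Or.inl ⟨a, hc, by omega⟩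
    · exact Or.inr ⟨a, ha, hm⟩
    · exact Or.inl ⟨c, hc, h⟩

end Monomial

/-! ### Depth and maximal independent sets -/

namespace SimpleGraph

variable {V : Type v}

/-- `A` is a maximal independent set of the graph obtained from `G` by deleting the vertices in
`B`. -/
structure IsMaxIndepOff (G : SimpleGraph V) (B : Set V) (A : Finset V) : Prop where
  notMem : ∀ a ∈ A, a ∉ B
  indep : ∀ a ∈ A, ∀ b ∈ A, ¬ G.Adj a b
  maximal : ∀ x, x ∉ B → x ∈ A ∨ ∃ a ∈ A, G.Adj x a

/-- In the order given by `ρ`, the neighbors of a vertex that do not come after it form a clique. -/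
def IsElimination (G : SimpleGraph V) (ρ : V → ℕ) : Prop :=
  ∀ x a b, G.Adj x a → G.Adj x b → ρ a ≤ ρ x → ρ b ≤ ρ x → a ≠ b → G.Adj a b

open Abelian

variable (K : Type u) [Field K]

/-- The module `S / (I_G + (x_b : b ∈ B))`. -/
noncomputable abbrev deletionObj (G : SimpleGraph V) (B : Set V) :
    ModuleCat.{max u v} (MvPolynomial V K) :=
  quotObj (monomialIdeal K (edgeExponents G B))

lemma IsMaxIndepOff.of_union_neighborSet {G : SimpleGraph V} {B : Set V} {c : V} (hc : c ∉ B)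
    {A : Finset V} (hA : G.IsMaxIndepOff (B ∪ G.neighborSet c) A) : G.IsMaxIndepOff B A := by
  have hcA : c ∈ A := by
    rcases hA.maximal c (by simp [hc]) with h | ⟨a, ha, h⟩
    · exact h
    · exact absurd (Or.inr h) (hA.notMem a ha)
  refine ⟨fun a ha h => hA.notMem a ha (Or.inl h), hA.indep, fun x hx => ?_⟩
  by_cases hxc : G.Adj c x
  · exact Or.inr ⟨c, hcA, hxc.symm⟩
  · exact hA.maximal x (by simp [hx, hxc])

/-- If `G` has an elimination order, then `Ext^i(K, S / I)` vanishes for all `i` smaller than the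
sizes of the maximal independent sets. -/
theorem subsingleton_ext_of_lt_card [Finite V] {G : SimpleGraph V} {ρ : V → ℕ}
    (hρ : G.IsElimination ρ) (B : Set V) :
    ∀ d : ℕ, (∀ A, G.IsMaxIndepOff B A → d ≤ A.card) → ∀ i < d,
      Subsingleton (Ext.{max u v} (quotObj (MvPolynomial.idealOfVars V K))
        (deletionObj K G B) i) := by
  classical
  induction B using WellFoundedGT.induction with
  | ind B ih =>
    intro d hd i hi
    by_cases hedge : ∃ x, x ∉ B ∧ ∃ y, y ∉ B ∧ G.Adj x y
    · obtain ⟨f, ⟨hfB, c, hcB, hfc⟩, hmax⟩ := Set.exists_max_image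
        {x | x ∉ B ∧ ∃ y, y ∉ B ∧ G.Adj x y} ρ (Set.toFinite _) hedge
      have h1 := ih (B ∪ G.neighborSet c) (show B ⊂ _ from
        ⟨Set.subset_union_left, fun h => hfB (h (Or.inr hfc.symm))⟩) d
        (fun A hA => hd A (hA.of_union_neighborSet hcB)) i hi
      -- Only `c` could be undominated. Either `f ∈ A`, or some neighbor `a` of `f` is in `A`; since
      -- `f` is last, its neighbors outside `B` form a clique, so `a` is adjacent to `c`.
      have hins : ∀ A, G.IsMaxIndepOff (insert c B) A → G.IsMaxIndepOff B A := ?_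
      · have h2 := ih (insert c B) (Set.ssubset_insert hcB) d (fun A hA => hd A (hins A hA)) i hi
        exact Ext.subsingleton_of_shortExact_covariant
          (colonSequence_shortExact _ _ _ _
            (monomial_mul_mem_monomialIdeal (single_one_add_mem_edgeExponents hcB))
            (monomialIdeal_eq_sup mem_edgeExponents_insert)) h1 h2
      · refine fun A hA => ⟨fun a ha h => hA.notMem a ha (Or.inr h), hA.indep, fun x hx => ?_⟩
        by_cases hxc : x = c
        · subst hxc
          right
          rcases hA.maximal f (by simp [hfc.ne, hfB]) with h | ⟨a, ha, hfa⟩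
          · exact ⟨f, h, hfc.symm⟩
          · have haB := hA.notMem a ha
            simp only [Set.mem_insert_iff, not_or] at haB
            exact ⟨a, ha, hρ f x a hfc hfa (hmax x ⟨hx, f, hfB, hfc.symm⟩)
              (hmax a ⟨haB.2, f, hfB, hfa.symm⟩) (Ne.symm haB.1)⟩
        · exact hA.maximal x (by simp [hxc, hx])
    · push Not at hedge
      by_cases hB : ∃ c, c ∉ B
      · obtain ⟨c, hcB⟩ := hB
        have hN : B ∪ G.neighborSet c = B :=
          Set.union_eq_left.2 fun y hy => by_contra fun hyB => hedge c hcB y hyB hy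
        have hcol := single_one_add_mem_edgeExponents (G := G) hcB
        rw [hN] at hcol
        refine subsingleton_ext_of_regular (r := MvPolynomial.monomial (Finsupp.single c 1) 1)
          (monomial_mul_mem_monomialIdeal hcol) (monomialIdeal_eq_sup mem_edgeExponents_insert)
          (smul_id_eq_zero (show MvPolynomial.X c ∈ MvPolynomial.idealOfVars V K from
            Ideal.subset_span (Set.mem_range_self c)))
          -- Deleting the isolated vertex `c` lowers sizes of maximal independent sets by one; the
          -- regular element `x_c` restores the loss.
          (ih (insert c B) (Set.ssubset_insert hcB) (d - 1) fun A hA => ?_) i (by omega)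
        have hcA : c ∉ A := fun h => hA.notMem c h (Set.mem_insert c B)
        have hA' : ∀ a ∈ insert c A, a ∉ B := by
          intro a ha h
          rcases Finset.mem_insert.1 ha with rfl | ha
          · exact hcB h
          · exact hA.notMem a ha (Or.inr h)
        have := hd (insert c A) ⟨hA', fun a ha b hb => hedge a (hA' a ha) b (hA' b hb), ?_⟩
        · rw [Finset.card_insert_of_notMem hcA] at this
          omega
        · intro x hx
          by_cases hxc : x = c
          · exact Or.inl (by simp [hxc])
          · rcases hA.maximal x (by simp [hxc, hx]) with h | ⟨a, ha, h⟩
            · exact Or.inl (Finset.mem_insert_of_mem h)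
            · exact Or.inr ⟨a, Finset.mem_insert_of_mem ha, h⟩
      · push Not at hB
        have := hd ∅ ⟨by simp, by simp, fun x hx => absurd (hB x) hx⟩
        simp only [Finset.card_empty] at this
        omega

/-- The module `S / (x_v : v ∉ A) + (x_v ^ 2 : v ∈ D)`. -/
noncomputable abbrev squareObj (A D : Finset V) : ModuleCat.{max u v} (MvPolynomial V K) :=
  quotObj (monomialIdeal K (squareExponents (A : Set V) (D : Set V)))

/-- Vanishing passes from the residue field to a module filtered by copies of it. -/
lemma subsingleton_ext_squareObj [DecidableEq V] (Y : ModuleCat.{max u v} (MvPolynomial V K))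
    (i : ℕ)
    (h : Subsingleton (Ext.{max u v} (quotObj (MvPolynomial.idealOfVars V K)) Y i))
    (D : Finset V) : Subsingleton (Ext.{max u v} (squareObj K D D) Y i) := by
  induction D using Finset.induction with
  | empty => simpa [squareObj, ← idealOfVars_eq_monomialIdeal] using h
  | insert c D hc ih =>
    have hc' : c ∉ (D : Set V) := hc
    have := Ext.subsingleton_of_shortExact_contravariant
      (colonSequence_shortExact _ _ _ _
        (monomial_mul_mem_monomialIdeal (K := K) (single_one_add_mem_squareExponents hc'))
        (monomialIdeal_eq_sup (mem_squareExponents_iff_insert hc'))) ih ih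
    rw [squareObj, Finset.coe_insert]
    exact this

/-- Dimension shifting along the regular squares `x_c²`, `c ∈ A \ D`, which kill the first argument,
reduces to the identity of `squareObj K A A`, where `s` acts nontrivially. -/
lemma ext_squareObj [DecidableEq V] (A : Finset V) {s : V →₀ ℕ}
    (hs : s ∉ squareExponents (A : Set V) A) (n : ℕ) :
    ∀ D ⊆ A, (A \ D).card = n →
      (∀ i < n, Subsingleton (Ext.{max u v} (squareObj K A A) (squareObj K A D) i)) ∧
      ∃ x : Ext.{max u v} (squareObj K A A) (squareObj K A D) n,
        MvPolynomial.monomial s (1 : K) • x ≠ 0 := by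
  induction n with
  | zero =>
    intro D hD hcard
    obtain rfl : D = A :=
      hD.antisymm (Finset.sdiff_eq_empty_iff_subset.1 (Finset.card_eq_zero.1 hcard))
    refine ⟨by simp, Ext.mk₀ (𝟙 _), fun h0 => hs ?_⟩
    rw [← Ext.mk₀_smul, Ext.mk₀_eq_zero_iff] at h0
    have := congrArg (fun φ => φ.hom (Submodule.Quotient.mk 1)) h0
    rw [← mulHom_self _ _ (fun p hp => Ideal.mul_mem_left _ _ hp)] at this
    have h1 := (Submodule.Quotient.mk_eq_zero _).1 this
    exact monomial_mem_monomialIdeal_iff.1 (by simpa using h1)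
  | succ n ih =>
    intro D hD hcard
    obtain ⟨c, hc⟩ : (A \ D).Nonempty := Finset.card_pos.1 (by omega)
    rw [Finset.mem_sdiff] at hc
    obtain ⟨h1, h2⟩ := ih (insert c D) (Finset.insert_subset hc.1 hD) (by
      rw [Finset.sdiff_insert, Finset.card_erase_of_mem (Finset.mem_sdiff.2 hc), hcard]
      rfl)
    have hcol := monomial_mul_mem_monomialIdeal (K := K)
      (single_two_add_mem_squareExponents (A := (A : Set V)) (D := (D : Set V)) hc.1 hc.2)
    have hsup := monomialIdeal_eq_sup (K := K)
      (mem_squareExponents_insert (A := (A : Set V)) (D := (D : Set V)) (c := c))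
    rw [squareObj, squareObj, Finset.coe_insert] at h1 h2
    have hvan := subsingleton_ext_of_regular hcol hsup (smul_id_eq_zero
      (monomial_mem_monomialIdeal 1 (Or.inr ⟨c, hc.1, by simp⟩))) h1
    exact ⟨hvan, exists_smul_ne_zero_of_regular hcol hsup (hvan n (by omega)) h2⟩

/-- A maximal independent set of size `n` gives a nonzero class in `Ext^n(K, S / I_G)`. -/
theorem nontrivial_ext_card {G : SimpleGraph V} {A : Finset V} (hA : G.IsMaxIndepOff ∅ A) :
    Nontrivial (Ext.{max u v} (quotObj (MvPolynomial.idealOfVars V K))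
      (deletionObj K G ∅) A.card) := by
  classical
  by_contra hn
  rw [not_nontrivial_iff_subsingleton] at hn
  have hsub := subsingleton_ext_squareObj K _ _ hn A
  set s : V →₀ ℕ := ∑ a ∈ A, Finsupp.single a 1
  have hs : ∀ x, s x = if x ∈ A then 1 else 0 := fun x => by
    simp [s, Finsupp.finsetSum_apply, Finsupp.single_apply]
  have hsq : s ∉ squareExponents (A : Set V) A := by
    rintro (⟨a, ha, h⟩ | ⟨a, ha, h⟩) <;> rw [hs] at h <;> split_ifs at h
    · exact ha ‹_›
    · exact h rfl
    · omega
    · omega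
  have hx := (ext_squareObj K A hsq A.card ∅ (by simp) (by simp)).2
  rw [← not_nontrivial_iff_subsingleton] at hsub
  refine hsub (nontrivial_ext_of_factor ?_ ?_ hx)
  · refine monomialIdeal_le_iff.2 fun m hm => monomial_mem_monomialIdeal 1 ?_
    rcases hm with ⟨b, hb, -⟩ | ⟨a, b, hab, ha, hb⟩
    · exact absurd hb (Set.notMem_empty b)
    · by_cases haA : a ∈ A
      · exact Or.inl ⟨b, fun hbA => hA.indep a haA b hbA hab, hb⟩
      · exact Or.inl ⟨a, haA, ha⟩
  · intro p hp
    rw [mem_monomialIdeal] at hp ⊢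
    intro m hm
    rw [MvPolynomial.coeff_monomial_mul'] at hm
    split_ifs at hm with hle
    · rw [one_mul] at hm
      have hpos : ∀ a ∈ A, m a ≠ 0 := fun a ha => by
        have := hle a
        rw [hs, if_pos ha] at this
        omega
      rcases hp _ hm with ⟨b, hb, hmb⟩ | ⟨b, hb, -⟩
      · rcases hA.maximal b (Set.notMem_empty b) with h | ⟨a, ha, hba⟩
        · exact absurd h hb
        · refine Or.inr ⟨b, a, hba, fun h0 => hmb ?_, hpos a ha⟩
          rw [Finsupp.tsub_apply, h0, Nat.zero_sub]
      · simp at hb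
    · exact absurd rfl hm

/-- The depth of `S_G / I_G` is the least size of a maximal independent set, if `G` has an
elimination order. -/
theorem edgeDepth_eq_of_isElimination [Finite V] {G : SimpleGraph V} {ρ : V → ℕ}
    (hρ : G.IsElimination ρ) {A : Finset V} (hA : G.IsMaxIndepOff ∅ A)
    (hmin : ∀ A', G.IsMaxIndepOff ∅ A' → A.card ≤ A'.card) :
    G.edgeDepth K = A.card := by
  have hI := edgeIdeal_eq_monomialIdeal (K := K) G
  rw [edgeDepth, polyDepth, hI]
  refine le_antisymm (iInf₂_le A.card (nontrivial_ext_card K hA)) (le_iInf₂ fun i hi => ?_)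
  by_contra hlt
  rw [not_le, Nat.cast_lt] at hlt
  exact not_subsingleton_iff_nontrivial.2 hi
    (subsingleton_ext_of_lt_card K hρ ∅ _ hmin i hlt)

end SimpleGraph

/-! ### Maximal independent sets and elimination orders under `∘` -/

namespace SimpleGraph

variable {V₁ V₂ : Type v} {G₁ : SimpleGraph V₁} {G₂ : SimpleGraph V₂} {f₁ v₁ : V₁} {f₂ v₂ : V₂}

lemma IsLeafAt.adj_iff {V : Type v} {G : SimpleGraph V} {f v : V} (h : G.IsLeafAt f v) (x : V) :
    G.Adj f x ↔ x = v := by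
  rw [← mem_neighborSet, h, Set.mem_singleton_iff]

lemma IsLeafAt.adj {V : Type v} {G : SimpleGraph V} {f v : V} (h : G.IsLeafAt f v) : G.Adj f v :=
  (h.adj_iff v).2 rfl

/-- All of `G₂` is placed after `v₁`, which also plays the role of `v₂`; this agrees with `ρ₂`
because `v₂` is minimal there. -/
lemma IsElimination.circ {ρ₁ : V₁ → ℕ} {ρ₂ : V₂ → ℕ} (h₁ : G₁.IsElimination ρ₁)
    (h₂ : G₂.IsElimination ρ₂) (hmin : ∀ x, ρ₂ v₂ ≤ ρ₂ x) :
    (G₁.circ G₂ f₁ v₁ f₂ v₂).IsElimination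
      (Sum.elim (fun x => ρ₁ x) fun x => ρ₂ x + ρ₁ v₁ + 1) := by
  rintro (x | x) (a | a) (b | b) hxa hxb ha hb hab <;> dsimp [SimpleGraph.circ] at *
  · exact h₁ x a b hxa hxb ha hb fun h => hab (congrArg Sum.inl (Subtype.ext h))
  · rw [hxb.1] at hb; omega
  · rw [hxa.1] at ha; omega
  · rw [hxb.1] at hb; omega
  · exact absurd (congrArg Sum.inl (Subtype.ext (hxa.1.trans hxb.1.symm))) hab
  · exact ⟨hxa.1, h₂ x v₂ b hxa.2.symm hxb (hmin x) (by omega) b.2.2.symm⟩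
  · exact ⟨hxb.1, h₂ x v₂ a hxb.2.symm hxa (hmin x) (by omega) a.2.2.symm⟩
  · exact h₂ x a b hxa hxb (by omega) (by omega) fun h => hab (congrArg Sum.inr (Subtype.ext h))

lemma IsMaxIndepOff.exists_of_circ_of_mem (h₁ : G₁.IsLeafAt f₁ v₁) (h₂ : G₂.IsLeafAt f₂ v₂)
    {A : Finset (CircVertex f₁ f₂ v₂)}
    (hA : (G₁.circ G₂ f₁ v₁ f₂ v₂).IsMaxIndepOff ∅ A)
    (hv : Sum.inl ⟨v₁, h₁.adj.ne.symm⟩ ∈ A) :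
    ∃ A₁ A₂, G₁.IsMaxIndepOff ∅ A₁ ∧ v₁ ∈ A₁ ∧ G₂.IsMaxIndepOff ∅ A₂ ∧ v₂ ∈ A₂ ∧
      A₁.card + A₂.card = A.card + 1 := by
  classical
  have hv₂ : v₂ ∉ A.toRight.map (Function.Embedding.subtype _) := by simp
  have hL : ∀ {x : V₁}, x ∈ A.toLeft.map (Function.Embedding.subtype _) ↔
      ∃ h : x ≠ f₁, Sum.inl ⟨x, h⟩ ∈ A := by simp
  have hR : ∀ {x : V₂}, x ∈ A.toRight.map (Function.Embedding.subtype _) ↔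
      ∃ h : x ≠ f₂ ∧ x ≠ v₂, Sum.inr ⟨x, h⟩ ∈ A := by simp
  refine ⟨A.toLeft.map (Function.Embedding.subtype _),
    insert v₂ (A.toRight.map (Function.Embedding.subtype _)), ⟨fun _ _ => id, ?_, ?_⟩,
    hL.2 ⟨_, hv⟩, ⟨fun _ _ => id, ?_, ?_⟩, Finset.mem_insert_self _ _, ?_⟩
  · intro a ha b hb hab
    obtain ⟨ha', ha⟩ := hL.1 ha
    obtain ⟨hb', hb⟩ := hL.1 hb
    exact hA.indep _ ha _ hb hab
  · intro x _
    by_cases hx : x = f₁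
    · subst hx
      exact Or.inr ⟨v₁, hL.2 ⟨_, hv⟩, h₁.adj⟩
    · rcases hA.maximal (Sum.inl ⟨x, hx⟩) (Set.notMem_empty _) with h | ⟨a | a, ha, h⟩
      · exact Or.inl (hL.2 ⟨hx, h⟩)
      · exact Or.inr ⟨a, hL.2 ⟨a.2, ha⟩, h⟩
      · obtain rfl : x = v₁ := h.1
        exact Or.inl (hL.2 ⟨_, hv⟩)
  · have key : ∀ b ∈ A.toRight.map (Function.Embedding.subtype _), ¬ G₂.Adj v₂ b := by
      intro b hb hab
      obtain ⟨hb', hb⟩ := hR.1 hb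
      exact hA.indep _ hv _ hb ⟨rfl, hab⟩
    intro a ha b hb hab
    rcases Finset.mem_insert.1 ha with rfl | ha <;> rcases Finset.mem_insert.1 hb with rfl | hb
    · exact hab.ne rfl
    · exact key b hb hab
    · exact key a ha hab.symm
    · obtain ⟨ha', ha⟩ := hR.1 ha
      obtain ⟨hb', hb⟩ := hR.1 hb
      exact hA.indep _ ha _ hb hab
  · intro x _
    by_cases hxv : x = v₂
    · exact Or.inl (Finset.mem_insert.2 (Or.inl hxv))
    by_cases hxf : x = f₂
    · subst hxf
      exact Or.inr ⟨v₂, Finset.mem_insert_self _ _, h₂.adj⟩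
    rcases hA.maximal (Sum.inr ⟨x, hxf, hxv⟩) (Set.notMem_empty _) with h | ⟨a | a, ha, h⟩
    · exact Or.inl (Finset.mem_insert_of_mem (hR.2 ⟨⟨hxf, hxv⟩, h⟩))
    · exact Or.inr ⟨v₂, Finset.mem_insert_self _ _, h.2.symm⟩
    · exact Or.inr ⟨a, Finset.mem_insert_of_mem (hR.2 ⟨a.2, ha⟩), h⟩
  · rw [Finset.card_insert_of_notMem hv₂, Finset.card_map, Finset.card_map, ← add_assoc,
      Finset.card_toLeft_add_card_toRight]

lemma IsMaxIndepOff.exists_of_circ_of_notMem (h₁ : G₁.IsLeafAt f₁ v₁)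
    {A : Finset (CircVertex f₁ f₂ v₂)}
    (hA : (G₁.circ G₂ f₁ v₁ f₂ v₂).IsMaxIndepOff ∅ A)
    (hv : Sum.inl ⟨v₁, h₁.adj.ne.symm⟩ ∉ A) :
    ∃ A₁ A₂, G₁.IsMaxIndepOff {f₁, v₁} A₁ ∧ G₂.IsMaxIndepOff {f₂, v₂} A₂ ∧
      A₁.card + A₂.card = A.card := by
  classical
  have hL : ∀ {x : V₁}, x ∈ A.toLeft.map (Function.Embedding.subtype _) ↔
      ∃ h : x ≠ f₁, Sum.inl ⟨x, h⟩ ∈ A := by simp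
  have hR : ∀ {x : V₂}, x ∈ A.toRight.map (Function.Embedding.subtype _) ↔
      ∃ h : x ≠ f₂ ∧ x ≠ v₂, Sum.inr ⟨x, h⟩ ∈ A := by simp
  refine ⟨A.toLeft.map (Function.Embedding.subtype _),
    A.toRight.map (Function.Embedding.subtype _), ⟨?_, ?_, ?_⟩, ⟨?_, ?_, ?_⟩, ?_⟩
  · intro a ha hmem
    obtain ⟨ha', ha⟩ := hL.1 ha
    rcases hmem with rfl | rfl
    · exact ha' rfl
    · exact hv ha
  · intro a ha b hb hab
    obtain ⟨ha', ha⟩ := hL.1 ha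
    obtain ⟨hb', hb⟩ := hL.1 hb
    exact hA.indep _ ha _ hb hab
  · intro x hx
    simp only [Set.mem_insert_iff, Set.mem_singleton_iff, not_or] at hx
    rcases hA.maximal (Sum.inl ⟨x, hx.1⟩) (Set.notMem_empty _) with h | ⟨a | a, ha, h⟩
    · exact Or.inl (hL.2 ⟨hx.1, h⟩)
    · exact Or.inr ⟨a, hL.2 ⟨a.2, ha⟩, h⟩
    · exact absurd h.1 hx.2
  · intro a ha hmem
    obtain ⟨ha', -⟩ := hR.1 ha
    rcases hmem with rfl | rfl
    · exact ha'.1 rfl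
    · exact ha'.2 rfl
  · intro a ha b hb hab
    obtain ⟨ha', ha⟩ := hR.1 ha
    obtain ⟨hb', hb⟩ := hR.1 hb
    exact hA.indep _ ha _ hb hab
  · intro x hx
    simp only [Set.mem_insert_iff, Set.mem_singleton_iff, not_or] at hx
    rcases hA.maximal (Sum.inr ⟨x, hx⟩) (Set.notMem_empty _) with h | ⟨a | a, ha, h⟩
    · exact Or.inl (hR.2 ⟨hx, h⟩)
    · obtain ⟨a, ha'⟩ := a
      obtain rfl : a = v₁ := h.1
      exact absurd ha hv
    · exact Or.inr ⟨a, hR.2 ⟨a.2, ha⟩, h⟩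
  · rw [Finset.card_map, Finset.card_map, Finset.card_toLeft_add_card_toRight]

lemma IsMaxIndepOff.exists_circ_of_mem (h₁ : G₁.IsLeafAt f₁ v₁) (h₂ : G₂.IsLeafAt f₂ v₂)
    {A₁ : Finset V₁} {A₂ : Finset V₂} (hA₁ : G₁.IsMaxIndepOff ∅ A₁) (hv₁ : v₁ ∈ A₁)
    (hA₂ : G₂.IsMaxIndepOff ∅ A₂) (hv₂ : v₂ ∈ A₂) :
    ∃ A, (G₁.circ G₂ f₁ v₁ f₂ v₂).IsMaxIndepOff ∅ A ∧ A.card + 1 = A₁.card + A₂.card := by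
  classical
  have hf₁ : f₁ ∉ A₁ := fun h => hA₁.indep _ h _ hv₁ h₁.adj
  have hf₂ : f₂ ∉ A₂ := fun h => hA₂.indep _ h _ hv₂ h₂.adj
  have hvf := h₁.adj.ne.symm
  refine ⟨(A₁.subtype _).disjSum (A₂.subtype _), ⟨fun _ _ => id, ?_, ?_⟩, ?_⟩
  · rintro (a | a) ha (b | b) hb hab <;>
      simp only [Finset.inl_mem_disjSum, Finset.inr_mem_disjSum, Finset.mem_subtype] at ha hb
    · exact hA₁.indep _ ha _ hb hab
    · exact hA₂.indep _ hv₂ _ hb hab.2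
    · exact hA₂.indep _ hv₂ _ ha hab.2
    · exact hA₂.indep _ ha _ hb hab
  · rintro (x | x) -
    · rcases hA₁.maximal x (Set.notMem_empty _) with h | ⟨a, ha, h⟩
      · exact Or.inl (by simpa using h)
      · exact Or.inr ⟨Sum.inl ⟨a, ne_of_mem_of_not_mem ha hf₁⟩, by simpa using ha, h⟩
    · rcases hA₂.maximal x (Set.notMem_empty _) with h | ⟨a, ha, h⟩
      · exact Or.inl (by simpa using h)
      · by_cases hav : a = v₂
        · subst hav
          exact Or.inr ⟨Sum.inl ⟨v₁, hvf⟩, by simpa using hv₁, rfl, h.symm⟩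
        · exact Or.inr ⟨Sum.inr ⟨a, ne_of_mem_of_not_mem ha hf₂, hav⟩, by simpa using ha, h⟩
  · rw [Finset.card_disjSum, Finset.card_subtype, Finset.card_subtype,
      Finset.filter_true_of_mem fun a ha => ne_of_mem_of_not_mem ha hf₁]
    have : A₂.filter (fun x => x ≠ f₂ ∧ x ≠ v₂) = A₂.erase v₂ := by
      ext x
      simp only [Finset.mem_filter, Finset.mem_erase]
      exact ⟨fun h => ⟨h.2.2, h.1⟩, fun h => ⟨h.2, ne_of_mem_of_not_mem h.2 hf₂, h.1⟩⟩
    rw [this, add_assoc, Finset.card_erase_add_one hv₂]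

lemma IsMaxIndepOff.exists_circ_of_notMem
    {A₁ : Finset V₁} {A₂ : Finset V₂} (hA₁ : G₁.IsMaxIndepOff {f₁, v₁} A₁)
    (hA₂ : G₂.IsMaxIndepOff {f₂, v₂} A₂) (hv : ∃ a ∈ A₁, G₁.Adj v₁ a) :
    ∃ A, (G₁.circ G₂ f₁ v₁ f₂ v₂).IsMaxIndepOff ∅ A ∧ A.card = A₁.card + A₂.card := by
  classical
  have hm₁ : ∀ a ∈ A₁, a ≠ f₁ ∧ a ≠ v₁ := fun a ha => by simpa using hA₁.notMem a ha
  have hm₂ : ∀ a ∈ A₂, a ≠ f₂ ∧ a ≠ v₂ := fun a ha => by simpa using hA₂.notMem a ha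
  refine ⟨(A₁.subtype _).disjSum (A₂.subtype _), ⟨fun _ _ => id, ?_, ?_⟩, ?_⟩
  · rintro (a | a) ha (b | b) hb hab <;>
      simp only [Finset.inl_mem_disjSum, Finset.inr_mem_disjSum, Finset.mem_subtype] at ha hb
    · exact hA₁.indep _ ha _ hb hab
    · exact (hm₁ _ ha).2 hab.1
    · exact (hm₁ _ hb).2 hab.1
    · exact hA₂.indep _ ha _ hb hab
  · rintro (x | x) -
    · by_cases hx : x.1 = v₁
      · obtain ⟨a, ha, h⟩ := hv
        exact Or.inr ⟨Sum.inl ⟨a, (hm₁ a ha).1⟩, by simpa using ha, show G₁.Adj x a from hx ▸ h⟩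
      · rcases hA₁.maximal x (by simp [x.2, hx]) with h | ⟨a, ha, h⟩
        · exact Or.inl (by simpa using h)
        · exact Or.inr ⟨Sum.inl ⟨a, (hm₁ a ha).1⟩, by simpa using ha, h⟩
    · rcases hA₂.maximal x (by simp [x.2.1, x.2.2]) with h | ⟨a, ha, h⟩
      · exact Or.inl (by simpa using h)
      · exact Or.inr ⟨Sum.inr ⟨a, hm₂ a ha⟩, by simpa using ha, h⟩
  · rw [Finset.card_disjSum, Finset.card_subtype, Finset.card_subtype,
      Finset.filter_true_of_mem fun a ha => (hm₁ a ha).1, Finset.filter_true_of_mem hm₂]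

/-- `m` is the least size of a maximal independent set of `G` that contains `v`, and `l` is the
least size of a maximal independent set of `G \ {f, v}`, attained by one that meets the
neighborhood of `v`. -/
structure IsLeafSize {V : Type v} (G : SimpleGraph V) (f v : V) (m l : ℕ) : Prop where
  le_of_mem : ∀ A, G.IsMaxIndepOff ∅ A → v ∈ A → m ≤ A.card
  exists_mem : ∃ A, G.IsMaxIndepOff ∅ A ∧ v ∈ A ∧ A.card = m
  le_of_off : ∀ A, G.IsMaxIndepOff {f, v} A → l ≤ A.card
  exists_off : ∃ A, G.IsMaxIndepOff {f, v} A ∧ (∃ a ∈ A, G.Adj v a) ∧ A.card = l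

theorem edgeDepth_circ (K : Type u) [Field K] [Finite V₁] [Finite V₂] {ρ₁ : V₁ → ℕ} {ρ₂ : V₂ → ℕ}
    (hρ₁ : G₁.IsElimination ρ₁) (hρ₂ : G₂.IsElimination ρ₂) (hmin : ∀ x, ρ₂ v₂ ≤ ρ₂ x)
    (h₁ : G₁.IsLeafAt f₁ v₁) (h₂ : G₂.IsLeafAt f₂ v₂) {m₁ l₁ m₂ l₂ : ℕ}
    (hs₁ : G₁.IsLeafSize f₁ v₁ m₁ l₁) (hs₂ : G₂.IsLeafSize f₂ v₂ m₂ l₂) :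
    (G₁.circ G₂ f₁ v₁ f₂ v₂).edgeDepth K = (min (m₁ + m₂ - 1) (l₁ + l₂) : ℕ) := by
  have hρ := hρ₁.circ (f₁ := f₁) (v₁ := v₁) (f₂ := f₂) hρ₂ hmin
  have hle : ∀ A, (G₁.circ G₂ f₁ v₁ f₂ v₂).IsMaxIndepOff ∅ A →
      min (m₁ + m₂ - 1) (l₁ + l₂) ≤ A.card := by
    intro A hA
    by_cases hv : Sum.inl ⟨v₁, h₁.adj.ne.symm⟩ ∈ A
    · obtain ⟨A₁, A₂, hA₁, hv₁, hA₂, hv₂, hc⟩ := hA.exists_of_circ_of_mem h₁ h₂ hv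
      have := hs₁.le_of_mem A₁ hA₁ hv₁
      have := hs₂.le_of_mem A₂ hA₂ hv₂
      omega
    · obtain ⟨A₁, A₂, hA₁, hA₂, hc⟩ := hA.exists_of_circ_of_notMem h₁ hv
      have := hs₁.le_of_off A₁ hA₁
      have := hs₂.le_of_off A₂ hA₂
      omega
  obtain ⟨A₁, hA₁, hv₁, hc₁⟩ := hs₁.exists_mem
  obtain ⟨A₂, hA₂, hv₂, hc₂⟩ := hs₂.exists_mem
  obtain ⟨A, hA, hc⟩ := IsMaxIndepOff.exists_circ_of_mem h₁ h₂ hA₁ hv₁ hA₂ hv₂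
  obtain ⟨B₁, hB₁, hb₁, hd₁⟩ := hs₁.exists_off
  obtain ⟨B₂, hB₂, -, hd₂⟩ := hs₂.exists_off
  -- A neighbor on one side is enough to dominate the glued vertex.
  obtain ⟨B, hB, hd⟩ := IsMaxIndepOff.exists_circ_of_notMem hB₁ hB₂ hb₁
  have hA' := hle A hA
  have hB' := hle B hB
  by_cases h : m₁ + m₂ - 1 ≤ l₁ + l₂
  · rw [edgeDepth_eq_of_isElimination K hρ hA fun A' hA' => ?_]
    · congr 1; omega
    · have := hle A' hA'
      omega
  · rw [edgeDepth_eq_of_isElimination K hρ hB fun A' hA' => ?_]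
    · congr 1; omega
    · have := hle A' hA'
      omega

end SimpleGraph

/-! ### Adjacency and elimination in fan graphs -/

namespace FanData

variable (F : FanData)

/-- The index set of the cliques attached to the central clique. -/
abbrev Branch : Type := Σ i : Fin F.k, Fin (F.r i)

/-- The vertices outside the central clique. -/
abbrev NewVertex : Type := Σ i : Fin F.k, Σ j : Fin (F.r i), Fin (F.a i j - ((j : ℕ) + 1))

variable {F}

/-- The attached clique that a new vertex belongs to. -/
def branch (z : F.NewVertex) : F.Branch := ⟨z.1, z.2.1⟩

lemma branch_surjective (b : F.Branch) : ∃ z : F.NewVertex, branch z = b :=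
  ⟨⟨b.1, b.2, ⟨0, Nat.sub_pos_of_lt (F.lt_a b.1 b.2)⟩⟩, rfl⟩

open Classical in
/-- The attached cliques that contain the central vertex `c`. -/
noncomputable def branchesAt (c : Fin F.n) : Finset F.Branch :=
  Finset.univ.filter fun b => ∃ l ≤ b.2, F.w b.1 l = c

open Classical in
/-- The attached cliques that have a new vertex outside `B`. -/
noncomputable def branchesOff (B : Set F.Vertex) : Finset F.Branch :=
  Finset.univ.filter fun b => ∃ z : F.NewVertex, branch z = b ∧ Sum.inr z ∉ B

lemma mem_branchesAt {c : Fin F.n} {b : F.Branch} :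
    b ∈ branchesAt c ↔ ∃ l ≤ b.2, F.w b.1 l = c := by
  simp [branchesAt]

lemma mem_branchesOff {B : Set F.Vertex} {b : F.Branch} :
    b ∈ branchesOff B ↔ ∃ z : F.NewVertex, branch z = b ∧ Sum.inr z ∉ B := by
  simp [branchesOff]

lemma branchesOff_empty : branchesOff (∅ : Set F.Vertex) = Finset.univ := by
  ext b
  simpa [mem_branchesOff] using branch_surjective b

lemma graph_adj_inl_inl {c d : Fin F.n} :
    F.graph.Adj (Sum.inl c) (Sum.inl d) ↔ c ≠ d :=
  ⟨fun h h' => h.1 (congrArg Sum.inl h'),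
    fun h => ⟨fun h' => h (Sum.inl_injective h'), Or.inl ⟨c, d, rfl, rfl⟩⟩⟩

lemma inl_mem_branchClique {c : Fin F.n} {i : Fin F.k} {j : Fin (F.r i)} :
    Sum.inl c ∈ F.branchClique i j ↔ (⟨i, j⟩ : F.Branch) ∈ branchesAt c := by
  simp [branchClique, mem_branchesAt, eq_comm]

lemma inr_mem_branchClique {z : F.NewVertex} {i : Fin F.k} {j : Fin (F.r i)} :
    Sum.inr z ∈ F.branchClique i j ↔ branch z = ⟨i, j⟩ := by
  constructor
  · rintro (⟨l, -, h⟩ | ⟨y, h⟩)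
    · cases h
    · cases h
      rfl
  · intro h
    obtain ⟨i', j', y⟩ := z
    cases h
    exact Or.inr ⟨y, rfl⟩

lemma graph_adj_inl_inr {c : Fin F.n} {z : F.NewVertex} :
    F.graph.Adj (Sum.inl c) (Sum.inr z) ↔ branch z ∈ branchesAt c := by
  constructor
  · rintro ⟨-, ⟨_, _, -, h⟩ | ⟨i, j, h, h'⟩⟩
    · cases h
    · rw [inr_mem_branchClique.1 h']
      exact inl_mem_branchClique.1 h
  · intro h
    exact ⟨Sum.inl_ne_inr, Or.inr ⟨z.1, z.2.1, inl_mem_branchClique.2 h,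
      inr_mem_branchClique.2 rfl⟩⟩

lemma graph_adj_inr_inr {z z' : F.NewVertex} :
    F.graph.Adj (Sum.inr z) (Sum.inr z') ↔ z ≠ z' ∧ branch z = branch z' := by
  constructor
  · rintro ⟨hne, ⟨_, _, -, h⟩ | ⟨i, j, h, h'⟩⟩
    · cases h
    · exact ⟨fun h => hne (congrArg Sum.inr h),
        (inr_mem_branchClique.1 h).trans (inr_mem_branchClique.1 h').symm⟩
  · rintro ⟨hne, h⟩
    exact ⟨fun h => hne (Sum.inr_injective h), Or.inr ⟨z.1, z.2.1, inr_mem_branchClique.2 rfl,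
      inr_mem_branchClique.2 h.symm⟩⟩

lemma isElimination : F.graph.IsElimination (Sum.elim (fun _ => 0) fun _ => 1) := by
  rintro (x | x) (a | a) (b | b) hxa hxb ha hb hab
  · exact graph_adj_inl_inl.2 fun h => hab (congrArg Sum.inl h)
  · simp at hb
  · simp at ha
  · simp at ha
  · exact graph_adj_inl_inl.2 fun h => hab (congrArg Sum.inl h)
  · rw [graph_adj_inr_inr] at hxb
    rw [F.graph.adj_comm, graph_adj_inl_inr, hxb.2] at hxa
    exact graph_adj_inl_inr.2 hxa
  · rw [graph_adj_inr_inr] at hxa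
    rw [F.graph.adj_comm, graph_adj_inl_inr, hxa.2] at hxb
    exact (graph_adj_inl_inr.2 hxb).symm
  · rw [graph_adj_inr_inr] at hxa hxb
    exact graph_adj_inr_inr.2 ⟨fun h => hab (congrArg Sum.inr h), hxa.2.symm.trans hxb.2⟩

/-! ### Maximal independent sets of fan graphs -/

/-- The attached clique of a vertex, if it is not central. -/
def branch? (x : F.Vertex) : Option F.Branch := Sum.elim (fun _ => none) (fun z => some (branch z)) x

variable {B : Set F.Vertex} {A : Finset F.Vertex}

lemma card_of_inl_mem (hA : F.graph.IsMaxIndepOff B A) {c : Fin F.n} (hc : Sum.inl c ∈ A) :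
    (branchesOff B \ branchesAt c).card + 1 ≤ A.card := by
  classical
  -- `none` counts the central vertex; every attached clique avoiding it must be hit by a new
  -- vertex.
  rw [← Finset.card_insertNone]
  refine le_trans (Finset.card_le_card ?_) (Finset.card_image_le (s := A) (f := branch?))
  rintro (_ | b) hb
  · exact Finset.mem_image.2 ⟨_, hc, rfl⟩
  · rw [Finset.some_mem_insertNone, Finset.mem_sdiff] at hb
    obtain ⟨z, rfl, hz⟩ := mem_branchesOff.1 hb.1
    rcases hA.maximal _ hz with h | ⟨d | y, ha, h⟩
    · exact Finset.mem_image.2 ⟨_, h, rfl⟩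
    · have hcd : c = d := by_contra fun hcd => hA.indep _ hc _ ha (graph_adj_inl_inl.2 hcd)
      exact absurd (hcd ▸ graph_adj_inl_inr.1 h.symm) hb.2
    · exact Finset.mem_image.2 ⟨_, ha, congrArg some (graph_adj_inr_inr.1 h).2.symm⟩

lemma card_branchesOff_le (hA : F.graph.IsMaxIndepOff B A) (hc : ∀ c, Sum.inl c ∉ A) :
    (branchesOff B).card ≤ A.card := by
  classical
  rw [← Finset.card_map Function.Embedding.some]
  refine le_trans (Finset.card_le_card ?_) (Finset.card_image_le (s := A) (f := branch?))
  intro b hb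
  obtain ⟨b, hb', rfl⟩ := Finset.mem_map.1 hb
  obtain ⟨z, rfl, hz⟩ := mem_branchesOff.1 hb'
  rcases hA.maximal _ hz with h | ⟨d | y, ha, h⟩
  · exact Finset.mem_image.2 ⟨_, h, rfl⟩
  · exact absurd ha (hc d)
  · exact Finset.mem_image.2 ⟨_, ha, congrArg some (graph_adj_inr_inr.1 h).2.symm⟩

/-- If `A` has no central vertex, it meets every surviving attached clique. One of these contains
`c₀`, since `c₀` has a neighbor in `A`; this pays for the `+ 1`. -/
lemma exists_card_le (hA : F.graph.IsMaxIndepOff B A) {c₀ : Fin F.n} (hc₀ : Sum.inl c₀ ∉ B) :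
    ∃ c, Sum.inl c ∉ B ∧ (branchesOff B \ branchesAt c).card + 1 ≤ A.card := by
  classical
  by_cases h : ∃ c, Sum.inl c ∈ A
  · obtain ⟨c, hc⟩ := h
    exact ⟨c, hA.notMem _ hc, card_of_inl_mem hA hc⟩
  · push Not at h
    refine ⟨c₀, hc₀, le_trans ?_ (card_branchesOff_le hA h)⟩
    rcases hA.maximal _ hc₀ with h' | ⟨d | y, ha, h'⟩
    · exact absurd h' (h c₀)
    · exact absurd ha (h d)
    · refine Finset.card_lt_card ⟨Finset.sdiff_subset, fun hsub => ?_⟩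
      exact (Finset.mem_sdiff.1 (hsub (mem_branchesOff.2 ⟨y, rfl, hA.notMem _ ha⟩))).2
        (graph_adj_inl_inr.1 h')

lemma exists_isMaxIndepOff {c : Fin F.n} (hc : Sum.inl c ∉ B) :
    ∃ A, F.graph.IsMaxIndepOff B A ∧ Sum.inl c ∈ A ∧
      A.card = (branchesOff B \ branchesAt c).card + 1 := by
  classical
  have : ∀ b : F.Branch, ∃ z : F.NewVertex, branch z = b ∧ (b ∈ branchesOff B → Sum.inr z ∉ B) := by
    intro b
    by_cases hb : b ∈ branchesOff B
    · obtain ⟨z, hz, hzB⟩ := mem_branchesOff.1 hb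
      exact ⟨z, hz, fun _ => hzB⟩
    · obtain ⟨z, hz⟩ := branch_surjective b
      exact ⟨z, hz, fun h => absurd h hb⟩
  choose σ hσ hσB using this
  have hinj : Function.Injective fun b => (Sum.inr (σ b) : F.Vertex) := fun b b' h => by
    rw [← hσ b, ← hσ b', Sum.inr_injective h]
  refine ⟨insert (Sum.inl c) ((branchesOff B \ branchesAt c).image fun b => Sum.inr (σ b)),
    ⟨?_, ?_, ?_⟩, Finset.mem_insert_self _ _, ?_⟩
  · intro a ha
    rcases Finset.mem_insert.1 ha with rfl | ha
    · exact hc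
    · obtain ⟨b, hb, rfl⟩ := Finset.mem_image.1 ha
      exact hσB b (Finset.mem_sdiff.1 hb).1
  · intro a ha b hb hab
    rcases Finset.mem_insert.1 ha with rfl | ha <;> rcases Finset.mem_insert.1 hb with rfl | hb
    · exact hab.ne rfl
    · obtain ⟨b, hb', rfl⟩ := Finset.mem_image.1 hb
      rw [graph_adj_inl_inr, hσ] at hab
      exact (Finset.mem_sdiff.1 hb').2 hab
    · obtain ⟨a, ha', rfl⟩ := Finset.mem_image.1 ha
      rw [F.graph.adj_comm, graph_adj_inl_inr, hσ] at hab
      exact (Finset.mem_sdiff.1 ha').2 hab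
    · obtain ⟨a, ha, rfl⟩ := Finset.mem_image.1 ha
      obtain ⟨b, hb, rfl⟩ := Finset.mem_image.1 hb
      rw [graph_adj_inr_inr, hσ, hσ] at hab
      exact hab.1 (congrArg σ hab.2)
  · rintro (d | z) hx
    · by_cases hdc : d = c
      · exact Or.inl (Finset.mem_insert.2 (Or.inl (congrArg Sum.inl hdc)))
      · exact Or.inr ⟨_, Finset.mem_insert_self _ _, graph_adj_inl_inl.2 hdc⟩
    · by_cases hz : branch z ∈ branchesAt c
      · exact Or.inr ⟨_, Finset.mem_insert_self _ _, (graph_adj_inl_inr.2 hz).symm⟩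
      · have hmem := Finset.mem_insert_of_mem (b := Sum.inl c) (Finset.mem_image_of_mem
          (fun b => (Sum.inr (σ b) : F.Vertex))
          (Finset.mem_sdiff.2 ⟨mem_branchesOff.2 ⟨z, rfl, hx⟩, hz⟩))
        by_cases hzσ : z = σ (branch z)
        · left
          rw [hzσ]
          exact hmem
        · exact Or.inr ⟨_, hmem, graph_adj_inr_inr.2 ⟨hzσ, (hσ _).symm⟩⟩
  · rw [Finset.card_insert_of_notMem (by simp), Finset.card_image_of_injective _ hinj]

/-! ### Counting -/

/-- The cliques of a fan are nested along the enumeration, so the first vertex of `W_i` lies in all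
`r i` of them. -/
lemma branchesAt_w (i : Fin F.k) (l : Fin (F.r i)) :
    branchesAt (F.w i l) = (Finset.Ici l).map (Function.Embedding.sigmaMk i) := by
  ext ⟨i', j⟩
  rw [mem_branchesAt, Finset.mem_map]
  constructor
  · rintro ⟨l', hl', h⟩
    obtain rfl : i' = i := by_contra fun hne => F.w_disjoint i' i hne l' l h
    obtain rfl := F.w_injective _ h
    exact ⟨j, Finset.mem_Ici.2 hl', rfl⟩
  · rintro ⟨j', hj', h⟩
    cases h
    exact ⟨l, Finset.mem_Ici.1 hj', rfl⟩

lemma card_branchesAt_w (i : Fin F.k) (l : Fin (F.r i)) :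
    (branchesAt (F.w i l)).card = F.r i - l := by
  rw [branchesAt_w, Finset.card_map, Fin.card_Ici]

lemma exists_of_mem_branchesAt {c : Fin F.n} {b : F.Branch} (h : b ∈ branchesAt c) :
    ∃ i l, c = F.w i l := by
  obtain ⟨l, -, h⟩ := mem_branchesAt.1 h
  exact ⟨b.1, l, h.symm⟩

lemma card_part (i : Fin F.k) : (F.part i).card = F.r i := by
  rw [part, Finset.card_image_of_injective _ (F.w_injective i), Finset.card_univ, Fintype.card_fin]

lemma r_le_maxPart (i : Fin F.k) : F.r i ≤ F.maxPart := by
  rw [← card_part]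
  exact Finset.le_sup (f := fun i => (F.part i).card) (Finset.mem_univ i)

lemma exists_r_eq_maxPart (p : Fin F.k) : ∃ i, F.r i = F.maxPart := by
  obtain ⟨i, -, hi⟩ := Finset.exists_mem_eq_sup Finset.univ ⟨p, Finset.mem_univ p⟩
    fun i => (F.part i).card
  exact ⟨i, by rw [← card_part]; exact hi.symm⟩

lemma r_le_maxPart' {p i : Fin F.k} (h : i ≠ p) : F.r i ≤ F.maxPart' p := by
  have := Finset.le_sup (f := fun i => if i = p then (F.part i).card - 1 else (F.part i).card)
    (Finset.mem_univ i)
  rwa [if_neg h, card_part] at this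

lemma r_sub_one_le_maxPart' (p : Fin F.k) : F.r p - 1 ≤ F.maxPart' p := by
  have := Finset.le_sup (f := fun i => if i = p then (F.part i).card - 1 else (F.part i).card)
    (Finset.mem_univ p)
  rwa [if_pos rfl, card_part] at this

lemma maxPart'_eq (p : Fin F.k) :
    F.maxPart' p = F.r p - 1 ∨ ∃ i ≠ p, F.maxPart' p = F.r i := by
  obtain ⟨i, -, hi⟩ := Finset.exists_mem_eq_sup Finset.univ ⟨p, Finset.mem_univ p⟩
    fun i => if i = p then (F.part i).card - 1 else (F.part i).card
  by_cases h : i = p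
  · left
    rw [maxPart', hi, if_pos h, card_part, h]
  · right
    exact ⟨i, h, by rw [maxPart', hi, if_neg h, card_part]⟩

variable (F) in
/-- The depth of a fan graph. -/
lemma edgeDepth_graph (K : Type u) [Field K] (p : Fin F.k) :
    ∃ d : ℕ, F.graph.edgeDepth K = d ∧ d + F.maxPart = Fintype.card F.Branch + 1 := by
  classical
  have hcard : ∀ c : Fin F.n, (branchesOff ∅ \ branchesAt c).card + (branchesAt c).card =
      Fintype.card F.Branch := fun c => by
    rw [branchesOff_empty, Finset.card_sdiff_add_card_eq_card (Finset.subset_univ _),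
      Finset.card_univ]
  obtain ⟨i, hi⟩ := exists_r_eq_maxPart p
  have h0 : (⟨0, F.r_pos i⟩ : Fin (F.r i)).1 = 0 := rfl
  have hi' := card_branchesAt_w i ⟨0, F.r_pos i⟩
  obtain ⟨A, hA, -, hc⟩ := exists_isMaxIndepOff (F := F) (B := ∅) (c := F.w i ⟨0, F.r_pos i⟩)
    (Set.notMem_empty _)
  have h1 := hcard (F.w i ⟨0, F.r_pos i⟩)
  refine ⟨A.card, SimpleGraph.edgeDepth_eq_of_isElimination K isElimination hA fun A' hA' => ?_,
    by omega⟩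
  obtain ⟨c, -, hc'⟩ := exists_card_le hA' (c₀ := F.w i ⟨0, F.r_pos i⟩) (Set.notMem_empty _)
  have h2 := hcard c
  have h3 : (branchesAt c).card ≤ F.maxPart := by
    rcases (branchesAt c).eq_empty_or_nonempty with h | ⟨b, hb⟩
    · simp [h]
    · obtain ⟨j, l, rfl⟩ := exists_of_mem_branchesAt hb
      rw [card_branchesAt_w]
      exact (Nat.sub_le _ _).trans (r_le_maxPart j)
  omega

lemma card_of_center_mem (i : Fin F.k) (l : Fin (F.r i)) (hl : l.1 = 0) :
    (branchesOff ∅ \ branchesAt (F.w i l)).card + F.r i = Fintype.card F.Branch := by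
  classical
  have := card_branchesAt_w i l
  rw [hl, Nat.sub_zero] at this
  rw [← this, branchesOff_empty, Finset.card_sdiff_add_card_eq_card (Finset.subset_univ _),
      Finset.card_univ]

/-- A leaf whose neighbor is in the part `W_p` is either the only new vertex of the first clique
attached at `W_p`, or the other vertex of a central clique of size two. -/
lemma isLeafAt_cases {f : F.Vertex} {c : Fin F.n} {p : Fin F.k}
    (hf : F.graph.IsLeafAt f (Sum.inl c)) (hc : c ∈ F.part p) :
    c = F.w p ⟨0, F.r_pos p⟩ ∧
      ((∃ z : F.NewVertex, f = Sum.inr z ∧ ∀ z', branch z' = ⟨p, ⟨0, F.r_pos p⟩⟩ ↔ z' = z) ∨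
        (∃ d : Fin F.n, f = Sum.inl d ∧ (∀ e, e = d ∨ e = c) ∧
          ∀ b : F.Branch, b = ⟨p, ⟨0, F.r_pos p⟩⟩)) := by
  obtain ⟨l, -, hl⟩ := Finset.mem_image.1 hc
  rcases f with d | ⟨i, j, y⟩
  · have h1 : ∀ e, e = d ∨ e = c := fun e => by
      by_contra h
      push Not at h
      exact h.2 (Sum.inl_injective ((hf.adj_iff (Sum.inl e)).1 (graph_adj_inl_inl.2 h.1.symm)))
    have h2 : ∀ i l', F.w i l' = c := fun i l' => by
      refine (h1 _).resolve_left fun h => ?_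
      obtain ⟨z, hz⟩ := branch_surjective (F := F) ⟨i, l'⟩
      have := (hf.adj_iff (Sum.inr z)).1 (graph_adj_inl_inr.2 (hz ▸ mem_branchesAt.2
        ⟨l', le_rfl, h⟩))
      cases this
    refine ⟨(h2 _ _).symm, Or.inr ⟨d, rfl, h1, ?_⟩⟩
    rintro ⟨i, j⟩
    obtain rfl : i = p := by_contra fun hne =>
      F.w_disjoint i p hne j l ((h2 i j).trans (h2 p l).symm)
    rw [F.w_injective i ((h2 i j).trans (h2 i ⟨0, F.r_pos i⟩).symm)]
  · have h1 : ∀ l' ≤ j, F.w i l' = c := fun l' hl' =>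
      Sum.inl_injective ((hf.adj_iff _).1 (F.graph.adj_symm (graph_adj_inl_inr.2
        (mem_branchesAt.2 ⟨l', hl', rfl⟩))))
    obtain rfl : i = p := by_contra fun hne =>
      F.w_disjoint i p hne j l ((h1 j le_rfl).trans hl.symm)
    have h0 := h1 ⟨0, F.r_pos i⟩ (Nat.zero_le _)
    obtain rfl := F.w_injective i ((h1 j le_rfl).trans h0.symm)
    refine ⟨h0.symm, Or.inl ⟨_, rfl, fun z' => ⟨fun hz' => by_contra fun hne => ?_, ?_⟩⟩⟩
    · have := (hf.adj_iff (Sum.inr z')).1 (graph_adj_inr_inr.2 ⟨Ne.symm hne, hz'.symm⟩)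
      cases this
    · rintro rfl
      rfl

/-- The sizes of the maximal independent sets relevant for gluing a fan graph at a leaf. -/
lemma exists_isLeafSize (hn : 2 ≤ F.n) {f : F.Vertex} {c : Fin F.n} {p : Fin F.k}
    (hf : F.graph.IsLeafAt f (Sum.inl c)) (hc : c ∈ F.part p) :
    ∃ m l, F.graph.IsLeafSize f (Sum.inl c) m l ∧ m + F.r p = Fintype.card F.Branch + 1 ∧
      l + F.maxPart' p = Fintype.card F.Branch := by
  classical
  obtain ⟨hcw, hcases⟩ := isLeafAt_cases hf hc
  have hcard : (branchesOff ∅ \ branchesAt c).card + F.r p = Fintype.card F.Branch :=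
    hcw ▸ card_of_center_mem p ⟨0, F.r_pos p⟩ rfl
  obtain ⟨A, hA, hcA, hAc⟩ := exists_isMaxIndepOff (F := F) (B := ∅) (c := c) (Set.notMem_empty _)
  suffices h : ∃ l, (∀ A, F.graph.IsMaxIndepOff {f, Sum.inl c} A → l ≤ A.card) ∧
      (∃ A, F.graph.IsMaxIndepOff {f, Sum.inl c} A ∧ (∃ a ∈ A, F.graph.Adj (Sum.inl c) a) ∧
        A.card = l) ∧ l + F.maxPart' p = Fintype.card F.Branch by
    obtain ⟨l, hl1, hl2, hl3⟩ := h
    exact ⟨A.card, l, ⟨fun A' hA' hc' => hAc ▸ card_of_inl_mem hA' hc', ⟨A, hA, hcA, rfl⟩, hl1,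
      hl2⟩, by omega, hl3⟩
  rcases hcases with ⟨z, rfl, hz⟩ | ⟨d, rfl, hd, hb⟩
  · have hoff : branchesOff {Sum.inr z, Sum.inl c} =
        Finset.univ.erase (⟨p, ⟨0, F.r_pos p⟩⟩ : F.Branch) := by
      ext b
      simp only [mem_branchesOff, Set.mem_insert_iff, Set.mem_singleton_iff, Finset.mem_erase,
        Finset.mem_univ, and_true, reduceCtorEq, or_false, Sum.inr.injEq]
      constructor
      · rintro ⟨z', rfl, hz'⟩ h
        exact hz' ((hz z').1 h)
      · intro hb
        obtain ⟨z', rfl⟩ := branch_surjective b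
        exact ⟨z', rfl, fun h => hb ((hz z').2 h)⟩
    have hcount : ∀ e, e ≠ c → (branchesOff {Sum.inr z, Sum.inl c} \ branchesAt e).card + 1 +
        (branchesAt e).card = Fintype.card F.Branch := by
      intro e he
      -- The first clique at `W_p`, lost with its only new vertex `f`, has `c` as its only central
      -- vertex.
      have hsub : branchesAt e ⊆ Finset.univ.erase (⟨p, ⟨0, F.r_pos p⟩⟩ : F.Branch) := by
        refine fun b hb => Finset.mem_erase.2 ⟨?_, Finset.mem_univ _⟩
        rintro rfl
        obtain ⟨l, hl, h⟩ := mem_branchesAt.1 hb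
        have hl0 : l = ⟨0, F.r_pos p⟩ := Fin.ext (Nat.le_zero.1 hl)
        exact he (by rw [← h, hcw, hl0])
      rw [hoff, add_right_comm, Finset.card_sdiff_add_card_eq_card hsub,
        Finset.card_erase_add_one (Finset.mem_univ _), Finset.card_univ]
    have hle : ∀ e, e ≠ c → (branchesAt e).card ≤ F.maxPart' p := by
      intro e he
      rcases (branchesAt e).eq_empty_or_nonempty with h | ⟨b, hb⟩
      · simp [h]
      · obtain ⟨j, l, rfl⟩ := exists_of_mem_branchesAt hb
        rw [card_branchesAt_w]
        by_cases hj : j = p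
        · subst hj
          have : l.1 ≠ 0 := fun h => he (by rw [hcw]; exact congrArg _ (Fin.ext h))
          exact le_trans (by omega) (r_sub_one_le_maxPart' j)
        · exact (Nat.sub_le _ _).trans (r_le_maxPart' hj)
    have hne : ∀ {e}, (Sum.inl e ∉ ({Sum.inr z, Sum.inl c} : Set F.Vertex)) ↔ e ≠ c := by simp
    obtain ⟨e₀, he₀⟩ : ∃ e, e ≠ c := by
      have : Nontrivial (Fin F.n) := Fin.nontrivial_iff_two_le.2 hn
      exact exists_ne c
    -- `T'` is attained at the second vertex of `W_p` or the first vertex of another part; if `T' =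
    -- 0`, any central vertex other than `c` works.
    have hex : ∃ e, e ≠ c ∧ (branchesAt e).card = F.maxPart' p := by
      rcases Nat.eq_zero_or_pos (F.maxPart' p) with h0 | hpos
      · exact ⟨e₀, he₀, le_antisymm (hle e₀ he₀) (h0 ▸ Nat.zero_le _)⟩
      · rcases maxPart'_eq p with h | ⟨i, hi, h⟩
        · have h1 : 1 < F.r p := by omega
          refine ⟨F.w p ⟨1, h1⟩, fun he => ?_, by rw [card_branchesAt_w, h]⟩
          have := congrArg Fin.val (F.w_injective p (he.trans hcw))
          exact absurd this one_ne_zero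
        · exact ⟨F.w i ⟨0, F.r_pos i⟩, fun he => F.w_disjoint i p hi _ _ (he.trans hcw),
            by rw [card_branchesAt_w, h]; rfl⟩
    obtain ⟨e, hec, he⟩ := hex
    obtain ⟨A', hA', heA', hA'c⟩ := exists_isMaxIndepOff (hne.2 hec)
    have h1 := hcount e hec
    refine ⟨A'.card, fun A'' hA'' => ?_, ⟨A', hA', ⟨_, heA', graph_adj_inl_inl.2 hec.symm⟩, rfl⟩,
      by omega⟩
    obtain ⟨g, hg, hgc⟩ := exists_card_le hA'' (hne.2 he₀)
    have h2 := hcount g (hne.1 hg)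
    have h3 := hle g (hne.1 hg)
    omega
  -- Here the center is the edge `{c, d}`, and deleting it leaves the new vertices of a single
  -- clique: `l = 1`.
  · have hN : Fintype.card F.Branch = 1 := Fintype.card_eq_one_iff.2 ⟨_, hb⟩
    have hr : F.r p = 1 := by
      refine le_antisymm (by_contra fun h => ?_) (F.r_pos p)
      have := hb ⟨p, ⟨1, by omega⟩⟩
      simp at this
    have hT : F.maxPart' p = 0 := by
      rcases maxPart'_eq p with h | ⟨i, hi, -⟩
      · omega
      · exact absurd (congrArg Sigma.fst (hb ⟨i, ⟨0, F.r_pos i⟩⟩)) hi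
    obtain ⟨z, hz⟩ := branch_surjective (F := F) ⟨p, ⟨0, F.r_pos p⟩⟩
    refine ⟨1, fun A hA => ?_, ⟨{Sum.inr z}, ⟨by simp, by simp, ?_⟩, ⟨Sum.inr z, by simp, ?_⟩,
      by simp⟩, by omega⟩
    · rw [Nat.one_le_iff_ne_zero, Finset.card_ne_zero]
      rcases hA.maximal (Sum.inr z) (by simp) with h | ⟨a, h, -⟩
      · exact ⟨_, h⟩
      · exact ⟨_, h⟩
    · rintro (e | z') hx
      · rcases hd e with rfl | rfl <;> simp at hx
      · by_cases h : z' = z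
        · exact Or.inl (by simp [h])
        · exact Or.inr ⟨_, Finset.mem_singleton_self _,
            graph_adj_inr_inr.2 ⟨h, (hb _).trans (hb _).symm⟩⟩
    · rw [graph_adj_inl_inr, hz, hcw, branchesAt_w]
      simp

end FanData

/-! ### Comparison of the two minima with the depths -/

theorem mainTheorem3 (K : Type u) [Field K] (F : Fin 2 → FanData)
    (hn : ∀ i, 2 ≤ (F i).n)
    (f v : (i : Fin 2) → (F i).Vertex)
    (hf : ∀ i, (F i).graph.IsLeafAt (f i) (v i))
    (p : (i : Fin 2) → Fin (F i).k)
    (hp : ∀ i, ∃ c ∈ (F i).part (p i), v i = Sum.inl c)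
    (t s : ℕ)
    (ht : t = (Finset.univ.filter
      fun i : Fin 2 => (F i).maxPart' (p i) ≠ (F i).maxPart - 1).card)
    (hs : s = if t ≤ 1 then 1 else 2) :
    ((F 0).graph.circ (F 1).graph (f 0) (v 0) (f 1) (v 1)).edgeDepth K ≠ ⊤ ∧
    (F 0).graph.edgeDepth K ≠ ⊤ ∧ (F 1).graph.edgeDepth K ≠ ⊤ ∧
    ((F 0).graph.circ (F 1).graph (f 0) (v 0) (f 1) (v 1)).edgeDepth K + s =
      (F 0).graph.edgeDepth K + (F 1).graph.edgeDepth K := by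
  have hsize : ∀ i, ∃ m l, (F i).graph.IsLeafSize (f i) (v i) m l ∧
      m + (F i).r (p i) = Fintype.card (F i).Branch + 1 ∧
      l + (F i).maxPart' (p i) = Fintype.card (F i).Branch := fun i => by
    obtain ⟨c, hc, hvc⟩ := hp i
    have hfi := hf i
    rw [hvc] at hfi ⊢
    exact FanData.exists_isLeafSize (hn i) hfi hc
  -- So `T'` is `T` or `T - 1`, and in the latter case `W_p` is a largest part.
  have hT : ∀ i, 1 ≤ (F i).r (p i) ∧ (F i).r (p i) ≤ (F i).maxPart ∧
      (F i).maxPart' (p i) ≤ (F i).maxPart ∧ (F i).maxPart ≤ (F i).maxPart' (p i) + 1 ∧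
      ((F i).maxPart' (p i) = (F i).maxPart - 1 → (F i).r (p i) = (F i).maxPart) := fun i => by
    have h1 := (F i).r_pos (p i)
    have h2 := FanData.r_le_maxPart (p i)
    have h3 := FanData.r_sub_one_le_maxPart' (p i)
    obtain ⟨j, hj⟩ := FanData.exists_r_eq_maxPart (p i)
    have h4 : (F i).maxPart' (p i) ≤ (F i).maxPart := by
      rcases FanData.maxPart'_eq (p i) with h | ⟨k, -, h⟩
      · omega
      · exact h ▸ FanData.r_le_maxPart k
    by_cases hjp : j = p i
    · rw [hjp] at hj
      omega
    · have := FanData.r_le_maxPart' hjp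
      omega
  obtain ⟨m₀, l₀, hs₀, hm₀, hl₀⟩ := hsize 0
  obtain ⟨m₁, l₁, hs₁, hm₁, hl₁⟩ := hsize 1
  obtain ⟨d₀, hd₀, hd₀'⟩ := (F 0).edgeDepth_graph K (p 0)
  obtain ⟨d₁, hd₁, hd₁'⟩ := (F 1).edgeDepth_graph K (p 1)
  have hmin : ∀ x : (F 1).Vertex, (Sum.elim (fun _ => 0) (fun _ => 1) (v 1) : ℕ) ≤
      Sum.elim (fun _ => 0) (fun _ => 1) x := fun x => by
    obtain ⟨c, -, hvc⟩ := hp 1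
    rw [hvc]
    exact Nat.zero_le _
  rw [SimpleGraph.edgeDepth_circ K FanData.isElimination FanData.isElimination hmin (hf 0) (hf 1)
    hs₀ hs₁, hd₀, hd₁]
  have h0 := hT 0
  have h1 := hT 1
  rw [Finset.card_filter, Fin.sum_univ_two] at ht
  -- Keeps the truncated `m₀ + m₁ - 1` exact.
  have hm₀' : 1 ≤ m₀ := by
    obtain ⟨A, -, hv, rfl⟩ := hs₀.exists_mem
    exact Finset.card_pos.2 ⟨_, hv⟩
  -- `l₀ + l₁ = d₀ + d₁ - t` and `m₀ + m₁ - 1 ≥ d₀ + d₁ - 1`, with equality if `t = 0`.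
  have key : min (m₀ + m₁ - 1) (l₀ + l₁) + s = d₀ + d₁ := by
    split_ifs at ht hs <;> omega
  exact ⟨ENat.natCast_ne_top _, ENat.natCast_ne_top _, ENat.natCast_ne_top _, mod_cast key⟩
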